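/- Let $\Omega\subset\mathbb R^d$ be a bounded open set with $C^1$ boundary, let $f\in C^1(\mathbb R^d;\mathbb R^d)$, and suppose that $\overline\Omega$ is invariant under the flow $\Phi^t$ ($t\ge 0$) of $\dot x=f(x)$. Let $w$ be a measurable function, positive almost everywhere on $\Omega$, with $w^{-1}\in W^{1,\infty}(\Omega)$ and $\operatorname{ess\,sup}_{\Omega}\|f\|\,w<\infty$. Put $X=L^1_w(\Omega)$ with norm $\|\phi\|_X=\int_\Omega|\phi|\,w\,dx$, identify $X^*$ with $L^\infty_w(\Omega)=\{\psi:\operatorname{ess\,sup}_\Omega|\psi w|<\infty\}$ through the pairing $\langle\phi,\psi\rangle_{X,X^*}=\int_\Omega\phi\,\psi\,w^2\,dx$, and let $H=L^2_{w^2}(\Omega)$ with $\|\psi\|_H^2=\int_\Omega\psi^2w^2\,dx$, so that $X^*\subset H\subset X$. Let $S^*(t)\psi=\psi\circ\Phi^t$ $(t\ge0)$ be the composition semigroup on $X^*$, let $A^*$ be its weak-* infinitesimal generator, i.e. $\psi\in\mathcal D(A^*)$ and $A^*\psi=\eta$ if and only if $\psi,\eta\in X^*$ and $\langle\phi,(S^*(t)\psi-\psi)/t\rangle_{X,X^*}\to\langle\phi,\eta\rangle_{X,X^*}$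 as $t\downarrow0$ for every $\phi\in X$, and let $S(t)$ be the preadjoint of $S^*(t)$, i.e. the bounded operators on $X$ with $\langle S(t)\phi,\psi\rangle_{X,X^*}=\langle\phi,S^*(t)\psi\rangle_{X,X^*}$ for all $\phi\in X$, $\psi\in X^*$. Assume that $S(t)$ is exponentially stable over $X$ with decay rate $\omega_0<0$: there is $M$ with $\|S(t)\|_{\mathcal L(X)}\le M e^{\omega_0t}$ for all $t\ge0$. Let $r\in\mathbb N$, $c_1,\dots,c_r\in X^*$, $C\colon X\to\mathbb R^r$, $C\phi=(\langle\phi,c_i\rangle_{X,X^*})_{i=1}^r$, with adjoint $C^*\colon\mathbb R^r\to X^*$, $C^*a=\sum_{i=1}^r a_ic_i$, and assume that $$\operatorname{range}(C^*)\subseteq\mathcal D((A^*)^m)\qquad\text{for some even } m\ge 0.$$ Let $\langle\phi,\psi\rangle_P=\int_0^\infty\langle CS(t)\phi,CS(t)\psi\rangle_{\mathbb R^r}\,dt$ for $\phi,\psi\in X$. Then this integral converges absolutely for all $\phi,\psi\in X$, and there is a sequence $(p_n)_{n\ge0}$ in $X^*$ such that $$\langle\phi,\psi\rangle_P=\sum_{n=0}^\infty\langle\phi,p_n\rangle_{X,X^*}\langle\psi,p_n\rangle_{X,X^*}\quad\text{for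 all }\phi,\psi\in X,$$ $$\sum_{n=0}^\infty\|p_n\|_H^2<\infty\qquad\text{and}\qquad \sum_{n=N}^\infty\|p_n\|_H^2=O(N^{-m})\quad\text{as }N\to\infty.$$ -/

import Mathlib

open MeasureTheory Filter Topology Set
open scoped ContDiff

noncomputable section

namespace KoopmanLyapunov

/-- `ℝ^d` with the Euclidean norm. -/
abbrev E (d : ℕ) : Type := EuclideanSpace ℝ (Fin d)

variable {d : ℕ}

/-- `Ω` has a boundary of class `C¹`: near each boundary point, `Ω` is the strict sublevel set of a
`C¹` function whose derivative does not vanish at that point. -/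
def HasC1Boundary (Ω : Set (E d)) : Prop :=
  ∀ x ∈ frontier Ω, ∃ U ∈ 𝓝 x, ∃ b : E d → ℝ,
    ContDiff ℝ 1 b ∧ fderiv ℝ b x ≠ 0 ∧ Ω ∩ U = {y | b y < 0} ∩ U

/-- `g` is the weak gradient of `u` on `Ω`. -/
def HasWeakGradient (Ω : Set (E d)) (u : E d → ℝ) (g : E d → E d) : Prop :=
  ∀ η : E d → ℝ, ContDiff ℝ ∞ η → HasCompactSupport η → tsupport η ⊆ Ω → ∀ v : E d,
    ∫ x in Ω, u x * fderiv ℝ η x v = - ∫ x in Ω, inner ℝ (g x) v * η x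

/-- The Sobolev space `W^{1,∞}(Ω)`. -/
def MemW1Infty (Ω : Set (E d)) (u : E d → ℝ) : Prop :=
  MemLp u ⊤ (volume.restrict Ω) ∧
    ∃ g : E d → E d, MemLp g ⊤ (volume.restrict Ω) ∧ HasWeakGradient Ω u g

/-- `Φ` is the forward flow on `closure Ω` of `x' = f x`; in particular `closure Ω` is
flow-invariant. The values `Φ t z` for `t < 0` or `z` outside `closure Ω` play no role. -/
structure IsForwardFlow (Ω : Set (E d)) (f : E d → E d) (Φ : ℝ → E d → E d) : Prop where
  initial : ∀ z ∈ closure Ω, Φ 0 z = z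
  invariant : ∀ z ∈ closure Ω, ∀ t, 0 ≤ t → Φ t z ∈ closure Ω
  deriv : ∀ z ∈ closure Ω, ∀ t, 0 ≤ t →
    HasDerivWithinAt (fun s => Φ s z) (f (Φ t z)) (Ici 0) t

/-- The standing assumptions on the domain `Ω`, the vector field `f`, the weight `w` and the
flow `Φ`. Note that `w⁻¹ ∈ W^{1,∞}(Ω)` and `f ∈ L^∞_w(Ω)` together make
`-(f ⬝ ∇w) / w = w * (f ⬝ ∇(w⁻¹))` essentially bounded on `Ω`. -/
structure StandingAssumptions (Ω : Set (E d)) (f : E d → E d) (w : E d → ℝ)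
    (Φ : ℝ → E d → E d) : Prop where
  isOpen : IsOpen Ω
  bounded : Bornology.IsBounded Ω
  c1_boundary : HasC1Boundary Ω
  smooth : ContDiff ℝ 1 f
  flow : IsForwardFlow Ω f Φ
  weight_measurable : Measurable w
  weight_pos : ∀ᵐ x ∂(volume.restrict Ω), 0 < w x
  weight_inv : MemW1Infty Ω (fun x => (w x)⁻¹)
  field_weighted : MemLp (fun x => w x • f x) ⊤ (volume.restrict Ω)

/-- The measure `ρ(x) dx` on `Ω`. -/
def weightedMeasure (Ω : Set (E d)) (ρ : E d → ℝ) : Measure (E d) :=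
  (volume.restrict Ω).withDensity (fun x => ENNReal.ofReal (ρ x))

/-- The Banach space `X = L^1_w(Ω)`, with norm `∫_Ω |φ| w dx`. -/
abbrev X (Ω : Set (E d)) (w : E d → ℝ) : Type := Lp ℝ 1 (weightedMeasure Ω w)

/-- (Representatives of) the elements of `X^* = L^∞_w(Ω)`: the functions `ψ` with
`ess sup_Ω |ψ w| < ∞`. -/
def XDual (Ω : Set (E d)) (w : E d → ℝ) : Submodule ℝ (E d → ℝ) where
  carrier := {ψ | MemLp (fun x => ψ x * w x) ⊤ (volume.restrict Ω)}
  zero_mem' := by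
    show MemLp (fun x => (0 : E d → ℝ) x * w x) ⊤ (volume.restrict Ω)
    simp
  add_mem' := by
    intro a b ha hb
    have h : MemLp (fun x => a x * w x + b x * w x) ⊤ (volume.restrict Ω) := MemLp.add ha hb
    simpa [add_mul] using h
  smul_mem' := by
    intro k a ha
    have h : MemLp (fun x => k * (a x * w x)) ⊤ (volume.restrict Ω) := MemLp.const_mul ha k
    simpa [mul_assoc] using h

/-- The dual pairing `⟨φ, ψ⟩_{X,X^*} = ∫_Ω φ ψ w² dx`. -/
def pairing {Ω : Set (E d)} {w : E d → ℝ} (φ : X Ω w) (ψ : E d → ℝ) : ℝ :=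
  ∫ x in Ω, φ x * ψ x * w x ^ 2

/-- The norm of `H = L^2_{w²}(Ω)`. -/
def hNorm (Ω : Set (E d)) (w : E d → ℝ) (ψ : E d → ℝ) : ℝ :=
  (eLpNorm ψ 2 (weightedMeasure Ω (fun x => w x ^ 2))).toReal

/-- The composition semigroup `S^*(t) ψ = ψ ∘ Φ^t`. -/
def koopman (Φ : ℝ → E d → E d) (t : ℝ) (ψ : E d → ℝ) : E d → ℝ := fun z => ψ (Φ t z)

/-- `S(t)`, `t ≥ 0`, is the preadjoint on `X` of the composition semigroup on `X^*`. -/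
def IsPreadjoint {Ω : Set (E d)} {w : E d → ℝ} (Φ : ℝ → E d → E d)
    (S : ℝ → X Ω w →L[ℝ] X Ω w) : Prop :=
  ∀ t, 0 ≤ t → ∀ (φ : X Ω w) (ψ : XDual Ω w), pairing (S t φ) ψ = pairing φ (koopman Φ t ψ)

/-- `S(t)` is exponentially stable over `X` with decay rate `ω₀ < 0`. -/
def ExponentiallyStable {Ω : Set (E d)} {w : E d → ℝ} (S : ℝ → X Ω w →L[ℝ] X Ω w)
    (ω₀ : ℝ) : Prop :=
  ω₀ < 0 ∧ ∃ M : ℝ, ∀ t, 0 ≤ t → ‖S t‖ ≤ M * Real.exp (ω₀ * t)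

/-- `ψ ∈ D(A^*)` and `A^* ψ = η`, where `A^*` is the infinitesimal generator of the weak-*
continuous semigroup `S^*(t)` on `X^*`: `(S^*(t) ψ - ψ) / t → η` weakly-* as `t ↓ 0`. -/
def IsGeneratorValue {Ω : Set (E d)} {w : E d → ℝ} (Φ : ℝ → E d → E d)
    (ψ η : XDual Ω w) : Prop :=
  ∀ φ : X Ω w,
    Tendsto (fun t : ℝ => (pairing φ (koopman Φ t ψ) - pairing φ ψ) / t) (𝓝[>] 0)
      (𝓝 (pairing φ η))

/-- The domain `D((A^*)^m)`. -/
def domGeneratorPow {Ω : Set (E d)} {w : E d → ℝ} (Φ : ℝ → E d → E d) :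
    ℕ → Set (XDual Ω w)
  | 0 => univ
  | m + 1 => {ψ | ∃ η, IsGeneratorValue Φ ψ η ∧ η ∈ domGeneratorPow Φ m}

/-- The observation operator `C : X → ℝ^r`, `C φ = (⟨φ, c_i⟩)_i`. -/
def observation {Ω : Set (E d)} {w : E d → ℝ} {r : ℕ} (c : Fin r → XDual Ω w) (φ : X Ω w) :
    EuclideanSpace ℝ (Fin r) :=
  WithLp.toLp 2 (fun i => pairing φ (c i))

/-- The adjoint `C^* : ℝ^r → X^*`, `C^* a = ∑ a_i c_i`. -/
def observationAdjoint {Ω : Set (E d)} {w : E d → ℝ} {r : ℕ} (c : Fin r → XDual Ω w)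
    (a : EuclideanSpace ℝ (Fin r)) : XDual Ω w :=
  ∑ i, a i • c i

/-- The value bilinear form `⟨φ, ψ⟩_P = ∫_0^∞ ⟨C S(t) φ, C S(t) ψ⟩ dt`. -/
def valueForm {Ω : Set (E d)} {w : E d → ℝ} {r : ℕ} (c : Fin r → XDual Ω w)
    (S : ℝ → X Ω w →L[ℝ] X Ω w) (φ ψ : X Ω w) : ℝ :=
  ∫ t in Ioi (0 : ℝ), inner ℝ (observation c (S t φ)) (observation c (S t ψ))

end KoopmanLyapunov

end

/-! For one observable c, the curve t ↦ ⟨S(t)φ, c⟩ lies in L²(0,∞), and the value form is the L²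
inner product of two such curves. Fix a Parseval frame (e_n) of L²(0,∞) and put p_n = ∫₀^∞ e_n(s)
S^*(s)c ds. By Fubini, ⟨φ, p_n⟩ is the n-th frame coefficient of the curve, so Parseval's identity
is the asserted expansion, whatever the frame (`exists_expansion`).

The frame matters only for the tails. For a.e. x, p_n(x) w(x) is the n-th coefficient of the single
orbit s ↦ c(Φ^s x) w(x), so the tail of ∑ ‖p_n‖_H² is the integral over Ω of a squared coefficient
tail. As Ω has finite measure, it suffices to have one frame, independent of x, with tails O(N^{-m})
uniformly over almost all orbits (`exists_parseval_tail_bound`).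

Put m = 2k. The generator condition makes almost every orbit a k-fold iterated primitive from
infinity of functions that are O(e^{ω₀t}) (`ae_isDecayingChain`); duality statements become
pointwise ones through `ae_le_of_pairing_le`. Take a mesh uniform with 2^j cells in the variable
e^{-αt}, α = -ω₀/(k+1). Cells grow longer as t increases, but the decay of the k-th function
compensates, and polynomials of degree < k on the cells give L² error O(2^{-jk}). Listing the
cut-off monomials of all dyadic levels in one sequence and orthonormalizing yields nested spaces;
with about N frame vectors the squared error is O(N^{-2k}).

Finitely many observables are treated separately and their sequences interleaved. -/

noncomputable section

namespace KoopmanLyapunov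

/-! ### Parseval frames adapted to prescribed vectors -/

/-- Gram–Schmidt orthonormalization of a sequence with dense span yields a Parseval frame adapted
to the sequence. -/
theorem exists_adapted_parseval {G : Type*} [NormedAddCommGroup G] [InnerProductSpace ℝ G]
    [CompleteSpace G] (u : ℕ → G)
    (hu : ⊤ ≤ (Submodule.span ℝ (range u)).topologicalClosure) :
    ∃ e : ℕ → G, (∀ x y, HasSum (fun n => inner ℝ x (e n) * inner ℝ y (e n)) (inner ℝ x y)) ∧
      ∀ (N : ℕ), ∀ v ∈ Submodule.span ℝ (u '' Iio N), ∀ n, N ≤ n → inner ℝ v (e n) = 0 := by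
  -- If u is linearly dependent, some of these vectors are 0. They contribute nothing to Parseval's
  -- identity, so they are kept to preserve the indexing by ℕ; the nonzero ones form a Hilbert
  -- basis.
  let e := InnerProductSpace.gramSchmidtNormed ℝ u
  refine ⟨e, fun x y => ?_, fun N v hv n hn => ?_⟩
  · have ho := InnerProductSpace.gramSchmidtNormed_orthonormal' (𝕜 := ℝ) u
    have hr : Submodule.span ℝ (range e) = Submodule.span ℝ (range u) :=
      (InnerProductSpace.span_gramSchmidtNormed_range u).trans
        (InnerProductSpace.span_gramSchmidt ℝ u)
    have hsub : range e ⊆ insert 0 (range fun i : {i | e i ≠ 0} => e i) := by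
      rintro _ ⟨n, rfl⟩
      by_cases h : e n = 0
      · exact Or.inl h
      · exact Or.inr ⟨⟨n, h⟩, rfl⟩
    have hsp : ⊤ ≤ (Submodule.span ℝ (range fun i : {i | e i ≠ 0} => e i)).topologicalClosure := by
      refine hu.trans (Submodule.topologicalClosure_mono ?_)
      rw [← hr, ← Submodule.span_insert_zero (s := range fun i : {i | e i ≠ 0} => e i)]
      exact Submodule.span_mono hsub
    have h := (HilbertBasis.mk ho hsp).hasSum_inner_mul_inner x y
    rw [HilbertBasis.coe_mk] at h
    have h2 : HasSum ((fun n => inner ℝ x (e n) * inner ℝ y (e n)) ∘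
        ((↑) : {i | e i ≠ 0} → ℕ)) (inner ℝ x y) := by
      have hf : ((fun n => inner ℝ x (e n) * inner ℝ y (e n)) ∘ ((↑) : {i | e i ≠ 0} → ℕ)) =
          fun i : {i | e i ≠ 0} => inner ℝ x (e i) * inner ℝ (e i) y :=
        funext fun i => congrArg (inner ℝ x (e i) * ·) (real_inner_comm _ _)
      rw [hf]
      exact h
    refine (hasSum_subtype_iff_of_support_subset ?_).1 h2
    intro n hn h0
    apply hn
    simp [h0]
  · induction hv using Submodule.span_induction with
    | mem v hv =>
      obtain ⟨i, hi, rfl⟩ := hv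
      have := InnerProductSpace.gramSchmidt_inv_triangular ℝ u (lt_of_lt_of_le hi hn)
      simp only [e, InnerProductSpace.gramSchmidtNormed]
      rw [inner_smul_right, real_inner_comm, this, mul_zero]
    | zero => simp
    | add x y _ _ hx hy => rw [inner_add_left, hx, hy, add_zero]
    | smul a x _ hx => rw [inner_smul_left, hx, mul_zero]

theorem sum_inner_sq_le_of_parseval {G : Type*} [NormedAddCommGroup G] [InnerProductSpace ℝ G]
    {e : ℕ → G} (he : ∀ x y, HasSum (fun n => inner ℝ x (e n) * inner ℝ y (e n)) (inner ℝ x y))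
    (x : G) (s : Finset ℕ) : ∑ n ∈ s, inner ℝ x (e n) ^ 2 ≤ ‖x‖ ^ 2 := by
  rw [← real_inner_self_eq_norm_sq]
  refine (Finset.sum_le_sum fun n _ => (pow_two _).le).trans ?_
  exact sum_le_hasSum s (fun n _ => mul_self_nonneg _) (he x x)

/-- A separable Hilbert space admits a Parseval frame whose first `(k + 1) * Q` members capture
the span of prescribed vectors `a q i`, `q < Q`, `i < k`. -/
theorem exists_parseval_capturing {G : Type*} [NormedAddCommGroup G] [InnerProductSpace ℝ G]
    [CompleteSpace G] [TopologicalSpace.SeparableSpace G] (k : ℕ) (a : ℕ → ℕ → G) :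
    ∃ e : ℕ → G, (∀ x y, HasSum (fun n => inner ℝ x (e n) * inner ℝ y (e n)) (inner ℝ x y)) ∧
      ∀ (Q : ℕ), ∀ v ∈ Submodule.span ℝ {z | ∃ q < Q, ∃ i < k, z = a q i}, ∀ x : G,
        ∀ s : Finset ℕ, (∀ n ∈ s, (k + 1) * Q ≤ n) →
          ∑ n ∈ s, inner ℝ x (e n) ^ 2 ≤ ‖x - v‖ ^ 2 := by
  -- Blocks of length k + 1: the first k slots of block q hold a q i, the last holds a term of a
  -- dense sequence. The latter makes the span dense; the former puts all a q i with q < Q among the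
  -- first (k + 1) * Q terms.
  let u : ℕ → G := fun n => if n % (k + 1) < k then a (n / (k + 1)) (n % (k + 1))
    else TopologicalSpace.denseSeq G (n / (k + 1))
  have hmod : ∀ q i, i < k + 1 → (q * (k + 1) + i) % (k + 1) = i := fun q i hi => by
    rw [Nat.add_comm, Nat.add_mul_mod_self_right, Nat.mod_eq_of_lt hi]
  have hdiv : ∀ q i, i < k + 1 → (q * (k + 1) + i) / (k + 1) = q := fun q i hi => by
    rw [Nat.add_comm, Nat.add_mul_div_right _ _ k.succ_pos, Nat.div_eq_of_lt hi, zero_add]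
  have hu : ⊤ ≤ (Submodule.span ℝ (range u)).topologicalClosure := by
    have hsub : range (TopologicalSpace.denseSeq G) ⊆ (Submodule.span ℝ (range u) : Set G) := by
      rintro _ ⟨q, rfl⟩
      refine Submodule.subset_span ⟨q * (k + 1) + k, ?_⟩
      simp only [u, hmod q k k.lt_succ_self, hdiv q k k.lt_succ_self, lt_irrefl, if_false]
    intro x _
    exact closure_mono hsub (TopologicalSpace.denseRange_denseSeq G x)
  obtain ⟨e, he, ho⟩ := exists_adapted_parseval u hu
  refine ⟨e, he, fun Q v hv x s hs => ?_⟩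
  have hv' : v ∈ Submodule.span ℝ (u '' Iio ((k + 1) * Q)) := by
    refine Submodule.span_mono ?_ hv
    rintro _ ⟨q, hq, i, hi, rfl⟩
    refine ⟨q * (k + 1) + i, ?_, ?_⟩
    · show q * (k + 1) + i < (k + 1) * Q
      nlinarith
    · simp only [u, hmod q i (by omega), hdiv q i (by omega), hi, if_true]
  -- The later frame vectors are orthogonal to v, so x and x - v have the same coefficients there
  -- and Bessel's inequality applies to x - v.
  have := sum_inner_sq_le_of_parseval he (x - v) s
  convert this using 2 with n hn
  rw [inner_sub_left, ho _ v hv' n (hs n hn), sub_zero]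

/-! ### Piecewise polynomial approximation on a graded dyadic mesh -/

/-- A function with `k` successive primitives is approximated by a polynomial on an interval. -/
theorem exists_poly_approx (k : ℕ) (y : ℕ → ℝ → ℝ) {p q M : ℝ} (hpq : p ≤ q) (hp : 0 ≤ p)
    (hM : 0 ≤ M) (hint : ∀ j ≤ k, IntegrableOn (y j) (Ioi 0))
    (hrel : ∀ j < k, ∀ᵐ t, 0 < t → y j t = - ∫ s in Ioi t, y (j + 1) s)
    (hb : ∀ᵐ t, p < t → t ≤ q → |y k t| ≤ M) :
    ∃ c : ℕ → ℝ, ∀ᵐ t, p < t → t ≤ q →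
      |y 0 t - ∑ i ∈ Finset.range k, c i * t ^ i| ≤ M * (q - p) ^ k := by
  induction k generalizing y with
  | zero => exact ⟨0, by simpa using hb⟩
  | succ k ih =>
    obtain ⟨c, hc⟩ := ih (fun j => y (j + 1)) (fun j hj => hint (j + 1) (by omega))
      (fun j hj => hrel (j + 1) (by omega)) hb
    have hi1 : IntegrableOn (y 1) (Ioi 0) := hint 1 (by omega)
    set A : ℝ := - ∫ s in Ioi p, y 1 s with hA
    -- These are the coefficients of A plus the primitive, vanishing at p, of the previous
    -- polynomial. The new error is thus the integral over [p, t] of the old one, which gains a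
    -- factor q - p.
    refine ⟨fun i => if i = 0 then A - ∑ i ∈ Finset.range k, c i * p ^ (i + 1) / (i + 1)
      else c (i - 1) / i, ?_⟩
    filter_upwards [hrel 0 (by omega)] with t ht hpt htq
    rw [ht (hp.trans_lt hpt), Finset.sum_range_succ']
    have hi2 : IntegrableOn (y 1) (Ioi p) := hi1.mono_set (Ioi_subset_Ioi hp)
    have hiv : IntervalIntegrable (y 1) volume p t :=
      (intervalIntegrable_iff_integrableOn_Ioc_of_le hpt.le).2
        (hi2.mono_set Ioc_subset_Ioi_self)
    have h1 : (∫ s in p..t, y 1 s) = (∫ s in Ioi p, y 1 s) - ∫ s in Ioi t, y 1 s :=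
      (intervalIntegral.integral_Ioi_sub_Ioi hi2 hpt.le).symm
    have hQ : Continuous fun s : ℝ => ∑ i ∈ Finset.range k, c i * s ^ i := by fun_prop
    have h2 : (∫ s in p..t, ∑ i ∈ Finset.range k, c i * s ^ i) =
        ∑ i ∈ Finset.range k, (c i * t ^ (i + 1) / (i + 1) - c i * p ^ (i + 1) / (i + 1)) := by
      rw [intervalIntegral.integral_finsetSum]
      · refine Finset.sum_congr rfl fun i _ => ?_
        rw [intervalIntegral.integral_const_mul, integral_pow]
        ring
      · intro i _
        exact (by fun_prop : Continuous fun s : ℝ => c i * s ^ i).intervalIntegrable _ _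
    have h3 : (-∫ s in Ioi t, y (0 + 1) s) - (∑ i ∈ Finset.range k,
        (if i + 1 = 0 then A - ∑ i ∈ Finset.range k, c i * p ^ (i + 1) / (i + 1)
          else c (i + 1 - 1) / ((i + 1 : ℕ) : ℝ)) * t ^ (i + 1) +
        (if 0 = 0 then A - ∑ i ∈ Finset.range k, c i * p ^ (i + 1) / (i + 1)
          else c (0 - 1) / ((0 : ℕ) : ℝ)) * t ^ 0) =
        ∫ s in p..t, (y 1 s - ∑ i ∈ Finset.range k, c i * s ^ i) := by
      rw [intervalIntegral.integral_sub hiv (hQ.intervalIntegrable _ _), h1, h2,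
        Finset.sum_sub_distrib]
      simp only [Nat.succ_ne_zero, if_false, if_true, Nat.add_sub_cancel, pow_zero, mul_one, hA,
        zero_add]
      have : ∀ i, c i / ((i + 1 : ℕ) : ℝ) * t ^ (i + 1) = c i * t ^ (i + 1) / (i + 1) := by
        intro i; push_cast; ring
      simp only [this]
      ring
    rw [h3]
    have hL : 0 ≤ M * (q - p) ^ k := mul_nonneg hM (pow_nonneg (sub_nonneg.2 hpq) _)
    calc |∫ s in p..t, (y 1 s - ∑ i ∈ Finset.range k, c i * s ^ i)|
        ≤ M * (q - p) ^ k * |t - p| := by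
          rw [← Real.norm_eq_abs]
          refine intervalIntegral.norm_integral_le_of_norm_le_const_ae ?_
          filter_upwards [hc] with s hs hsm
          rw [uIoc_of_le hpt.le] at hsm
          exact hs hsm.1 (hsm.2.trans htq)
      _ ≤ M * (q - p) ^ k * (q - p) := by
          refine mul_le_mul_of_nonneg_left ?_ hL
          rw [abs_of_pos (sub_pos.2 hpt)]
          linarith
      _ = _ := by ring

/-- Lebesgue measure on the positive half-line. -/
abbrev halfLine : Measure ℝ := volume.restrict (Ioi (0 : ℝ))

theorem memLp_exp_neg {a : ℝ} (ha : 0 < a) : MemLp (fun t => Real.exp (-a * t)) 2 halfLine := by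
  rw [memLp_two_iff_integrable_sq (by fun_prop)]
  have := exp_neg_integrableOn_Ioi 0 (mul_pos two_pos ha)
  refine this.congr (Eventually.of_forall fun t => ?_)
  show Real.exp (-(2 * a) * t) = Real.exp (-a * t) ^ 2
  rw [← Real.exp_nat_mul]
  congr 1
  push_cast
  ring

/-- The monomial `t ^ i` cut off to the dyadic cell `l ≤ 2 ^ j * exp (-α t) < l + 1`, where
`q = 2 ^ j + l` and `0 < l < 2 ^ j`. -/
def cellMonomial (α : ℝ) (q i : ℕ) : ℝ → ℝ :=
  {t : ℝ | 0 < t ∧ 0 < q - 2 ^ Nat.log 2 q ∧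
    ((q - 2 ^ Nat.log 2 q : ℕ) : ℝ) ≤ 2 ^ Nat.log 2 q * Real.exp (-α * t) ∧
    2 ^ Nat.log 2 q * Real.exp (-α * t) < ((q - 2 ^ Nat.log 2 q : ℕ) : ℝ) + 1}.indicator
    fun t => t ^ i

theorem measurable_cellMonomial (α : ℝ) (q i : ℕ) : Measurable (cellMonomial α q i) := by
  refine Measurable.indicator (by fun_prop) ?_
  have hm : Measurable fun t : ℝ => (2 : ℝ) ^ Nat.log 2 q * Real.exp (-α * t) := by fun_prop
  exact (measurableSet_lt measurable_const measurable_id).inter ((MeasurableSet.const _).inter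
    ((measurableSet_le measurable_const hm).inter (measurableSet_lt hm measurable_const)))

/-- Since l ≥ 1 on a cell, 2 ^ j * exp (-α t) ≥ 1 bounds t by T. The unbounded cell l = 0 was
excluded from the definition for this reason. -/
theorem memLp_cellMonomial {α : ℝ} (hα : 0 < α) (q i : ℕ) :
    MemLp (cellMonomial α q i) 2 halfLine := by
  set T : ℝ := Real.log ((2 : ℝ) ^ Nat.log 2 q) / α with hT
  have hg : MemLp ((Ioc 0 T).indicator fun _ => T ^ i) 2 halfLine :=
    memLp_indicator_const 2 measurableSet_Ioc (T ^ i)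
      (Or.inr ((Measure.restrict_apply_le _ _).trans_lt (by simp)).ne)
  refine hg.mono (measurable_cellMonomial α q i).aestronglyMeasurable
    (Eventually.of_forall fun t => ?_)
  by_cases ht : cellMonomial α q i t = 0
  · rw [ht, norm_zero]; exact norm_nonneg _
  · obtain ⟨h0, h1, h2, -⟩ := mem_of_indicator_ne_zero ht
    have hl : (1 : ℝ) ≤ 2 ^ Nat.log 2 q * Real.exp (-α * t) := le_trans (by exact_mod_cast h1) h2
    have htT : t ≤ T := by
      rw [hT, le_div_iff₀ hα]
      have := Real.log_nonneg hl
      rw [Real.log_mul (by positivity) (Real.exp_ne_zero _), Real.log_exp] at this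
      linarith
    have hmem := mem_of_indicator_ne_zero ht
    rw [cellMonomial, indicator_of_mem hmem, indicator_of_mem (show t ∈ Ioc 0 T from ⟨h0, htT⟩),
      Real.norm_of_nonneg (by positivity), Real.norm_of_nonneg (pow_nonneg (h0.le.trans htT) _)]
    exact pow_le_pow_left₀ h0.le htT i

/-- `y 0, …, y k` are measurable, exponentially small, and each is minus the primitive from
infinity of the next. -/
structure IsDecayingChain (a M : ℝ) (k : ℕ) (y : ℕ → ℝ → ℝ) : Prop where
  meas : ∀ j ≤ k, AEStronglyMeasurable (y j) halfLine
  bound : ∀ j ≤ k, ∀ᵐ t, 0 < t → |y j t| ≤ M * Real.exp (-a * t)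
  rel : ∀ j < k, ∀ᵐ t, 0 < t → y j t = - ∫ s in Ioi t, y (j + 1) s

theorem IsDecayingChain.integrableOn {a M : ℝ} {k : ℕ} {y : ℕ → ℝ → ℝ} (ha : 0 < a)
    (h : IsDecayingChain a M k y) {j : ℕ} (hj : j ≤ k) : IntegrableOn (y j) (Ioi 0) := by
  refine ((exp_neg_integrableOn_Ioi 0 ha).const_mul M).mono' (h.meas j hj) ?_
  exact (ae_restrict_iff' measurableSet_Ioi).2 (h.bound j hj)

/-- On one cell of the graded dyadic mesh a decaying chain is close to a polynomial. -/
theorem IsDecayingChain.exists_cell_approx {α M : ℝ} {k : ℕ} {y : ℕ → ℝ → ℝ} (hα : 0 < α)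
    (hM : 0 ≤ M) (h : IsDecayingChain (α * (k + 1)) M k y) {N l : ℕ} (hl : 0 < l) (hlN : l < N) :
    ∃ c : ℕ → ℝ, ∀ᵐ t, (l : ℝ) ≤ N * Real.exp (-α * t) → N * Real.exp (-α * t) < (l : ℝ) + 1 →
      |y 0 t - ∑ i ∈ Finset.range k, c i * t ^ i| ≤
        2 * (2 / α) ^ k * M / N ^ k * Real.exp (-α * t) := by
  have hl0 : (0 : ℝ) < l := by exact_mod_cast hl
  have hl1 : (1 : ℝ) ≤ l := by exact_mod_cast hl
  have hN0 : (0 : ℝ) < N := by exact_mod_cast hl.trans hlN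
  have hlN' : (l : ℝ) + 1 ≤ N := by exact_mod_cast hlN
  -- In the time variable the cell is p < t ≤ q.
  set p : ℝ := Real.log (N / (l + 1)) / α with hp
  set q : ℝ := Real.log (N / l) / α with hq
  have hp0 : 0 ≤ p := div_nonneg (Real.log_nonneg (by rw [le_div_iff₀] <;> linarith)) hα.le
  have hexp : Real.exp (-α * p) = (l + 1) / N := by
    rw [hp, neg_mul, mul_div_cancel₀ _ hα.ne', Real.exp_neg, Real.exp_log (by positivity), inv_div]
  -- The length is log (1 + 1/l) / α; then log (1 + 1/l) ≤ 1/l ≤ 2/(l + 1), as l ≥ 1.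
  have hqp : q - p ≤ 2 / α * (1 / (l + 1)) := by
    rw [hq, hp, ← sub_div, ← Real.log_div (by positivity) (by positivity), div_le_iff₀ hα]
    have h1 : (N : ℝ) / l / (N / (l + 1)) = 1 + 1 / l := by field_simp
    have h2 := Real.log_le_sub_one_of_pos (show (0 : ℝ) < 1 + 1 / l by positivity)
    rw [h1]
    have h3 : 2 / α * (1 / ((l : ℝ) + 1)) * α = 2 / (l + 1) := by field_simp
    rw [h3]
    refine h2.trans ?_
    rw [add_sub_cancel_left, div_le_div_iff₀ hl0 (by positivity)]
    linarith
  have hpq : p ≤ q := by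
    rw [hp, hq]
    gcongr
    linarith
  have hb : ∀ᵐ t, p < t → t ≤ q → |y k t| ≤ M * Real.exp (-(α * (k + 1)) * p) := by
    filter_upwards [h.bound k le_rfl] with t ht hpt _
    refine (ht (hp0.trans_lt hpt)).trans (mul_le_mul_of_nonneg_left ?_ hM)
    rw [Real.exp_le_exp]
    have : 0 < α * (k + 1) := by positivity
    nlinarith
  obtain ⟨c, hc⟩ := exists_poly_approx k y hpq hp0 (by positivity)
    (fun j hj => h.integrableOn (by positivity) hj) h.rel hb
  refine ⟨c, ?_⟩
  filter_upwards [hc] with t ht h1 h2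
  have hpt : p < t := by
    have : Real.exp (-α * t) < Real.exp (-α * p) := by
      rw [hexp, lt_div_iff₀ hN0]; linarith
    rw [Real.exp_lt_exp] at this
    nlinarith
  have htq : t ≤ q := by
    have h3 : (l : ℝ) / N ≤ Real.exp (-α * t) := by rw [div_le_iff₀ hN0]; linarith
    have h4 := Real.log_le_log (by positivity) h3
    rw [Real.log_exp] at h4
    rw [hq, le_div_iff₀ hα, Real.log_div hN0.ne' hl0.ne']
    rw [Real.log_div hl0.ne' hN0.ne'] at h4
    linarith
  refine (ht hpt htq).trans ?_
  have e1 : Real.exp (-(α * (k + 1)) * p) = ((l + 1) / N) ^ (k + 1) := by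
    rw [← hexp, ← Real.exp_nat_mul]
    congr 1
    push_cast
    ring
  have e2 : ((l : ℝ) + 1) / N ≤ 2 * Real.exp (-α * t) := by
    rw [div_le_iff₀ hN0]; linarith
  -- The k-th power of the cell length cancels k of the k + 1 factors l + 1 produced by the decay.
  -- The one left over, (l + 1) / N, is at most 2 * exp (-α t) and makes the pointwise error square
  -- integrable over all cells together.
  calc M * Real.exp (-(α * (k + 1)) * p) * (q - p) ^ k
      ≤ M * ((l + 1) / N) ^ (k + 1) * (2 / α * (1 / (l + 1))) ^ k := by
        rw [e1]
        have := sub_nonneg.2 hpq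
        gcongr
    _ = (2 / α) ^ k * M / N ^ k * ((l + 1) / N) := by
        rw [pow_succ, div_pow, mul_pow, div_pow 1, one_pow]
        field_simp
    _ ≤ (2 / α) ^ k * M / N ^ k * (2 * Real.exp (-α * t)) := by gcongr
    _ = _ := by ring

theorem memLp_of_exp_bound {a M : ℝ} (ha : 0 < a) {f : ℝ → ℝ}
    (hf : AEStronglyMeasurable f halfLine)
    (hb : ∀ᵐ t, 0 < t → |f t| ≤ M * Real.exp (-a * t)) : MemLp f 2 halfLine := by
  refine ((memLp_exp_neg ha).const_mul M).mono hf ?_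
  rw [ae_restrict_iff' measurableSet_Ioi]
  filter_upwards [hb] with t ht h0
  exact (ht h0).trans (le_abs_self _)

/-- The class in `L²(0, ∞)` of a cut-off monomial. -/
def cellAtom {α : ℝ} (hα : 0 < α) (q i : ℕ) : Lp ℝ 2 halfLine :=
  (memLp_cellMonomial hα q i).toLp _

/-- A decaying chain is approximated by piecewise polynomials on the graded dyadic mesh. -/
theorem IsDecayingChain.exists_approx {α M : ℝ} {k : ℕ} {y : ℕ → ℝ → ℝ} (hα : 0 < α)
    (hM : 0 ≤ M) (h : IsDecayingChain (α * (k + 1)) M k y) (hy : MemLp (y 0) 2 halfLine) (j : ℕ) :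
    ∃ v ∈ Submodule.span ℝ {z | ∃ q < 2 ^ (j + 1), ∃ i < k, z = cellAtom hα q i},
      ‖hy.toLp (y 0) - v‖ ≤ (2 * (2 / α) ^ k + 1) * M / (2 ^ j) ^ k *
        ‖(memLp_exp_neg hα).toLp _‖ := by
  set N : ℕ := 2 ^ j with hN
  have hN0 : (0 : ℝ) < N := by positivity
  have key : ∀ l : ℕ, ∃ c : ℕ → ℝ, 0 < l → l < N → ∀ᵐ t, (l : ℝ) ≤ N * Real.exp (-α * t) →
      N * Real.exp (-α * t) < (l : ℝ) + 1 → |y 0 t - ∑ i ∈ Finset.range k, c i * t ^ i| ≤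
        2 * (2 / α) ^ k * M / N ^ k * Real.exp (-α * t) := by
    intro l
    by_cases hl : 0 < l ∧ l < N
    · obtain ⟨c, hc⟩ := h.exists_cell_approx hα hM hl.1 hl.2
      exact ⟨c, fun _ _ => hc⟩
    · exact ⟨0, fun h1 h2 => absurd ⟨h1, h2⟩ hl⟩
  choose c hc using key
  -- The index q = 2 ^ j + l encodes level and cell, so level j occupies the indices below 2 ^ (j +
  -- 1).
  have hlog : ∀ l < N, Nat.log 2 (N + l) = j := fun l hl =>
    (Nat.log_eq_iff (Or.inr ⟨by norm_num, by positivity⟩)).2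
      ⟨by omega, by rw [pow_succ]; omega⟩
  refine ⟨∑ l ∈ Finset.range N, ∑ i ∈ Finset.range k, c l i • cellAtom hα (N + l) i, ?_, ?_⟩
  · refine Submodule.sum_mem _ fun l hl => Submodule.sum_mem _ fun i hi =>
      Submodule.smul_mem _ _ (Submodule.subset_span ⟨N + l, ?_, i, Finset.mem_range.1 hi, rfl⟩)
    have := Finset.mem_range.1 hl
    rw [pow_succ]
    omega
  · refine Lp.norm_le_mul_norm_of_ae_le_mul ?_
    have hall : ∀ᵐ t, ∀ l : ℕ, 0 < l → l < N → (l : ℝ) ≤ N * Real.exp (-α * t) →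
        N * Real.exp (-α * t) < (l : ℝ) + 1 → |y 0 t - ∑ i ∈ Finset.range k, c l i * t ^ i| ≤
          2 * (2 / α) ^ k * M / N ^ k * Real.exp (-α * t) := by
      rw [ae_all_iff]
      intro l
      by_cases hl : 0 < l ∧ l < N
      · filter_upwards [hc l hl.1 hl.2] with t ht _ _ using ht
      · exact Eventually.of_forall fun t h1 h2 => absurd ⟨h1, h2⟩ hl
    have hcoe : (∑ l ∈ Finset.range N, ∑ i ∈ Finset.range k, c l i • cellAtom hα (N + l) i :
        Lp ℝ 2 halfLine) =ᵐ[halfLine] fun t => ∑ l ∈ Finset.range N, ∑ i ∈ Finset.range k,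
          c l i * cellMonomial α (N + l) i t := by
      have h1 : ∀ l i, (c l i • cellAtom hα (N + l) i : Lp ℝ 2 halfLine) =ᵐ[halfLine]
          fun t => c l i * cellMonomial α (N + l) i t := fun l i => by
        filter_upwards [Lp.coeFn_smul (c l i) (cellAtom hα (N + l) i),
          (memLp_cellMonomial hα (N + l) i).coeFn_toLp] with t h1 h2
        rw [h1, Pi.smul_apply, cellAtom, h2, smul_eq_mul]
      have h2 : ∀ l, ∀ᵐ t ∂halfLine, (∑ i ∈ Finset.range k, c l i • cellAtom hα (N + l) i :
          Lp ℝ 2 halfLine) t = ∑ i ∈ Finset.range k, (c l i • cellAtom hα (N + l) i :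
            Lp ℝ 2 halfLine) t := fun l => Lp.coeFn_fun_finsetSum _ _
      filter_upwards [Lp.coeFn_fun_finsetSum (Finset.range N) fun l =>
        ∑ i ∈ Finset.range k, c l i • cellAtom hα (N + l) i, ae_all_iff.2 h2,
        ae_all_iff.2 fun l => ae_all_iff.2 (h1 l)] with t h3 h4 h5
      rw [h3]
      refine Finset.sum_congr rfl fun l _ => ?_
      rw [h4 l]
      exact Finset.sum_congr rfl fun i _ => h5 l i
    filter_upwards [Lp.coeFn_sub (hy.toLp (y 0)) (∑ l ∈ Finset.range N,
      ∑ i ∈ Finset.range k, c l i • cellAtom hα (N + l) i), hcoe, hy.coeFn_toLp,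
      (memLp_exp_neg hα).coeFn_toLp, ae_restrict_of_ae hall,
      ae_restrict_of_ae (h.bound 0 (Nat.zero_le _)), ae_restrict_mem measurableSet_Ioi]
      with t h1 h2 h3 h4 h5 h6 h0
    rw [h1, Pi.sub_apply, h2, h3, h4, Real.norm_eq_abs, Real.norm_of_nonneg (Real.exp_pos _).le]
    have h0 : 0 < t := h0
    have hcell : ∀ l < N, ∀ i, cellMonomial α (N + l) i t = if 0 < l ∧
        (l : ℝ) ≤ N * Real.exp (-α * t) ∧ N * Real.exp (-α * t) < (l : ℝ) + 1 then t ^ i else 0 := by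
      intro l hl i
      rw [cellMonomial, hlog l hl, ← hN, Nat.add_sub_cancel_left, indicator_apply]
      simp only [mem_ofPred_eq, h0, true_and, hN, Nat.cast_pow, Nat.cast_ofNat]
    -- L is the only cell of level j that can contain t; L < N because t > 0.
    set L := ⌊N * Real.exp (-α * t)⌋₊ with hL
    have hpos : 0 ≤ N * Real.exp (-α * t) := by positivity
    have hlt : N * Real.exp (-α * t) < N := by
      have : Real.exp (-α * t) < 1 := by rw [Real.exp_lt_one_iff]; nlinarith
      nlinarith
    have hLN : L < N := by rw [hL, Nat.floor_lt hpos]; exact hlt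
    have hLe : (L : ℝ) ≤ N * Real.exp (-α * t) := Nat.floor_le hpos
    have hLt : N * Real.exp (-α * t) < (L : ℝ) + 1 := Nat.lt_floor_add_one _
    have hsum : ∑ l ∈ Finset.range N, ∑ i ∈ Finset.range k, c l i * cellMonomial α (N + l) i t =
        if 0 < L then ∑ i ∈ Finset.range k, c L i * t ^ i else 0 := by
      rw [Finset.sum_eq_single_of_mem L (Finset.mem_range.2 hLN)]
      · split_ifs with hL0
        · refine Finset.sum_congr rfl fun i _ => ?_
          rw [hcell L hLN, if_pos ⟨hL0, hLe, hLt⟩]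
        · refine Finset.sum_eq_zero fun i _ => ?_
          rw [hcell L hLN, if_neg fun h => hL0 h.1, mul_zero]
      · intro l hl hne
        refine Finset.sum_eq_zero fun i _ => ?_
        rw [hcell l (Finset.mem_range.1 hl), if_neg, mul_zero]
        rintro ⟨_, hl1, hl2⟩
        exact hne ((Nat.floor_eq_iff hpos).2 ⟨hl1, hl2⟩).symm
    have hNk : ((2 : ℝ) ^ j) ^ k = N ^ k := by rw [hN]; push_cast; rfl
    rw [hsum, hNk]
    have hE := Real.exp_pos (-α * t)
    split_ifs with hL0
    · refine (h5 L hL0 hLN hLe hLt).trans ?_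
      gcongr
      linarith
    -- On the unbounded cell L = 0 the approximant is 0. There exp (-α t) < 1 / N, so k of the k + 1
    -- factors in the decay of y 0 already give N ^ (-k); this accounts for the + 1 in the constant.
    · rw [sub_zero]
      refine (h6 h0).trans ?_
      have hL0' : L = 0 := by omega
      rw [hL0', Nat.cast_zero, zero_add] at hLt
      have e1 : Real.exp (-(α * (k + 1)) * t) = Real.exp (-α * t) ^ k * Real.exp (-α * t) := by
        rw [← pow_succ, ← Real.exp_nat_mul]
        congr 1
        push_cast
        ring
      have e2 : Real.exp (-α * t) ≤ 1 / N := by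
        rw [le_div_iff₀ hN0]; linarith
      calc M * Real.exp (-(α * (k + 1)) * t) = M * Real.exp (-α * t) ^ k * Real.exp (-α * t) := by
            rw [e1]; ring
        _ ≤ M * (1 / N) ^ k * Real.exp (-α * t) := by gcongr
        _ = 1 * M / N ^ k * Real.exp (-α * t) := by rw [div_pow, one_pow]; ring
        _ ≤ _ := by
          gcongr
          have : 0 ≤ 2 * (2 / α) ^ k := by positivity
          linarith

/-- There is a Parseval frame of `L²(0, ∞)` in which decaying chains of length `k` have
coefficient tails of order `N ^ (-2 * k)`. -/
theorem exists_parseval_tail_bound (k : ℕ) {α : ℝ} (hα : 0 < α) :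
    ∃ e : ℕ → Lp ℝ 2 halfLine,
      (∀ x y, HasSum (fun n => inner ℝ x (e n) * inner ℝ y (e n)) (inner ℝ x y)) ∧
      ∃ D : ℝ, 0 ≤ D ∧ ∀ (M : ℝ) (y : ℕ → ℝ → ℝ), 0 ≤ M →
        IsDecayingChain (α * (k + 1)) M k y → ∀ (hy : MemLp (y 0) 2 halfLine) (N : ℕ)
        (s : Finset ℕ), (∀ n ∈ s, N ≤ n) →
          ∑ n ∈ s, inner ℝ (hy.toLp (y 0)) (e n) ^ 2 ≤ (D * M / (N + 1) ^ k) ^ 2 := by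
  have : Fact ((2 : ENNReal) ≠ ⊤) := ⟨by norm_num⟩
  obtain ⟨e, he, hcap⟩ := exists_parseval_capturing (G := Lp ℝ 2 halfLine) k (cellAtom hα)
  set B : ℝ := ‖(memLp_exp_neg hα).toLp _‖ with hB
  have hB0 : 0 ≤ B := norm_nonneg _
  set D₀ : ℝ := 2 * (2 / α) ^ k + 1 with hD₀
  have hD₀1 : 1 ≤ D₀ := by
    have : 0 ≤ 2 * (2 / α) ^ k := by positivity
    linarith
  refine ⟨e, he, D₀ * B * (4 * (k + 1)) ^ k, by positivity, fun M y hM h hy N s hs => ?_⟩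
  have hN1 : (0 : ℝ) < N + 1 := by positivity
  -- For small N the plain norm bound suffices, since the factor (4 * (k + 1) / (N + 1)) ^ k is at
  -- least 1.
  by_cases hN : N + 1 < 4 * (k + 1)
  · have h0 : ‖hy.toLp (y 0)‖ ≤ M * B := by
      refine Lp.norm_le_mul_norm_of_ae_le_mul ?_
      filter_upwards [hy.coeFn_toLp, (memLp_exp_neg hα).coeFn_toLp,
        ae_restrict_of_ae (h.bound 0 (Nat.zero_le _)), ae_restrict_mem measurableSet_Ioi]
        with t h1 h2 h3 h4
      have h4 : 0 < t := h4
      rw [h1, h2, Real.norm_of_nonneg (Real.exp_pos _).le]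
      refine (h3 h4).trans (mul_le_mul_of_nonneg_left (Real.exp_le_exp.2 ?_) hM)
      have : 0 ≤ α * k * t := by positivity
      nlinarith
    refine (sum_inner_sq_le_of_parseval he _ s).trans (pow_le_pow_left₀ (norm_nonneg _) ?_ 2)
    refine h0.trans ?_
    have h5 : (1 : ℝ) ≤ (4 * (k + 1) / (N + 1)) ^ k := by
      refine one_le_pow₀ ?_
      rw [le_div_iff₀ hN1, one_mul]
      exact_mod_cast hN.le
    calc M * B = 1 * (M * B) * 1 := by ring
      _ ≤ D₀ * (M * B) * (4 * (k + 1) / (N + 1)) ^ k := by gcongr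
      _ = _ := by rw [div_pow]; ring
  -- Choose j maximal with (k + 1) * 2 ^ (j + 1) ≤ N. Then level j is captured before index N, while
  -- maximality gives 2 ^ (-j) ≤ 4 (k + 1) / (N + 1).
  · push Not at hN
    set L := Nat.log 2 (N / (k + 1)) with hL
    have hL1 : 2 ≤ N / (k + 1) := by
      rw [Nat.le_div_iff_mul_le (by omega)]
      omega
    have hL2 : 1 ≤ L := Nat.log_pos (by norm_num) hL1
    obtain ⟨j, hj⟩ : ∃ j, L = j + 1 := ⟨L - 1, by omega⟩
    have h2a : 2 ^ (j + 1) ≤ N / (k + 1) := by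
      rw [← hj]; exact Nat.pow_log_le_self 2 (by omega)
    have h2b : N / (k + 1) < 2 ^ (j + 2) := by
      have := Nat.lt_pow_succ_log_self (b := 2) (by norm_num) (N / (k + 1))
      rw [← hL, hj] at this
      exact this
    have h3a : (k + 1) * 2 ^ (j + 1) ≤ N := by
      rw [Nat.le_div_iff_mul_le (by omega)] at h2a
      linarith
    have h3b : N + 1 ≤ 4 * (k + 1) * 2 ^ j := by
      rw [Nat.div_lt_iff_lt_mul (by omega), pow_add] at h2b
      linarith
    obtain ⟨v, hv, hdist⟩ := h.exists_approx hα hM hy j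
    refine (hcap _ v hv _ s fun n hn => h3a.trans (hs n hn)).trans
      (pow_le_pow_left₀ (norm_nonneg _) (hdist.trans ?_) 2)
    have h4 : (1 : ℝ) / 2 ^ j ≤ 4 * (k + 1) / (N + 1) := by
      rw [div_le_div_iff₀ (by positivity) hN1, one_mul]
      exact_mod_cast h3b
    calc D₀ * M / (2 ^ j) ^ k * B = D₀ * M * B * (1 / 2 ^ j) ^ k := by
          rw [div_pow, one_pow]; ring
      _ ≤ D₀ * M * B * (4 * (k + 1) / (N + 1)) ^ k := by gcongr
      _ = _ := by rw [div_pow]; ring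

variable {d : ℕ} {Ω : Set (E d)} {w : E d → ℝ}

/-! ### Duality between weighted L¹ and weighted L^∞ -/

section Weighted

theorem integrable_weightedMeasure_iff (hw : Measurable w)
    (hpos : ∀ᵐ x ∂(volume.restrict Ω), 0 < w x) {h : E d → ℝ} :
    Integrable h (weightedMeasure Ω w) ↔ Integrable (fun x => h x * w x) (volume.restrict Ω) := by
  rw [weightedMeasure, integrable_withDensity_iff hw.ennreal_ofReal
    (Eventually.of_forall fun x => ENNReal.ofReal_lt_top)]
  refine integrable_congr ?_
  filter_upwards [hpos] with x hx
  rw [ENNReal.toReal_ofReal hx.le]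

theorem integral_weightedMeasure (hw : Measurable w)
    (hpos : ∀ᵐ x ∂(volume.restrict Ω), 0 < w x) (h : E d → ℝ) :
    ∫ x, h x ∂(weightedMeasure Ω w) = ∫ x in Ω, h x * w x := by
  rw [weightedMeasure, integral_withDensity_eq_integral_toReal_smul hw.ennreal_ofReal
    (Eventually.of_forall fun x => ENNReal.ofReal_lt_top)]
  refine integral_congr_ae ?_
  filter_upwards [hpos] with x hx
  rw [ENNReal.toReal_ofReal hx.le, smul_eq_mul, mul_comm]

theorem absolutelyContinuous_weightedMeasure (hw : Measurable w)
    (hpos : ∀ᵐ x ∂(volume.restrict Ω), 0 < w x) :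
    volume.restrict Ω ≪ weightedMeasure Ω w := by
  refine withDensity_absolutelyContinuous' hw.ennreal_ofReal.aemeasurable ?_
  filter_upwards [hpos] with x hx
  exact (ENNReal.ofReal_pos.2 hx).ne'

theorem X.integrable (hw : Measurable w) (hpos : ∀ᵐ x ∂(volume.restrict Ω), 0 < w x)
    (φ : X Ω w) : Integrable (fun x => φ x * w x) (volume.restrict Ω) :=
  (integrable_weightedMeasure_iff hw hpos).1 (L1.integrable_coeFn φ)

theorem X.norm_eq (hw : Measurable w) (hpos : ∀ᵐ x ∂(volume.restrict Ω), 0 < w x)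
    (φ : X Ω w) : ‖φ‖ = ∫ x in Ω, |φ x| * w x := by
  rw [L1.norm_eq_integral_norm, integral_weightedMeasure hw hpos]
  rfl

theorem exists_X_of_integrable (hw : Measurable w) (hpos : ∀ᵐ x ∂(volume.restrict Ω), 0 < w x)
    {h : E d → ℝ} (hh : Integrable (fun x => h x * w x) (volume.restrict Ω)) :
    ∃ φ : X Ω w, φ =ᵐ[volume.restrict Ω] h ∧ ‖φ‖ = ∫ x in Ω, |h x| * w x := by
  have hi := (integrable_weightedMeasure_iff hw hpos).2 hh
  have hae : hi.toL1 h =ᵐ[volume.restrict Ω] h :=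
    (absolutelyContinuous_weightedMeasure hw hpos).ae_le hi.coeFn_toL1
  refine ⟨hi.toL1 h, hae, ?_⟩
  rw [X.norm_eq hw hpos]
  refine integral_congr_ae ?_
  filter_upwards [hae] with x hx
  rw [hx]

theorem pairing_congr {φ : X Ω w} {θ θ' : E d → ℝ} (h : θ =ᵐ[volume.restrict Ω] θ') :
    pairing φ θ = pairing φ θ' := by
  refine integral_congr_ae ?_
  filter_upwards [h] with x hx
  rw [hx]

theorem integrable_pairing (hw : Measurable w) (hpos : ∀ᵐ x ∂(volume.restrict Ω), 0 < w x)
    (φ : X Ω w) {θ : E d → ℝ} (hθ : AEMeasurable θ (volume.restrict Ω)) {K : ℝ}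
    (hK : ∀ᵐ x ∂(volume.restrict Ω), |θ x| * w x ≤ K) :
    Integrable (fun x => φ x * θ x * w x ^ 2) (volume.restrict Ω) := by
  have h := (X.integrable hw hpos φ).mul_bdd (c := K) (g := fun x => θ x * w x)
    (hθ.mul hw.aemeasurable).aestronglyMeasurable (by
      filter_upwards [hK, hpos] with x hx hx0
      rw [norm_mul, Real.norm_of_nonneg hx0.le]
      exact hx)
  refine h.congr (Eventually.of_forall fun x => ?_)
  show φ x * w x * (θ x * w x) = _
  ring

theorem abs_pairing_le (hw : Measurable w) (hpos : ∀ᵐ x ∂(volume.restrict Ω), 0 < w x)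
    (φ : X Ω w) {θ : E d → ℝ} {K : ℝ} (hK : ∀ᵐ x ∂(volume.restrict Ω), |θ x| * w x ≤ K) :
    |pairing φ θ| ≤ K * ‖φ‖ := by
  rw [X.norm_eq hw hpos, ← integral_const_mul, ← Real.norm_eq_abs]
  refine norm_integral_le_of_norm_le ((X.integrable hw hpos φ).norm.const_mul K |>.congr ?_) ?_
  · filter_upwards [hpos] with x hx
    rw [norm_mul, Real.norm_of_nonneg hx.le, Real.norm_eq_abs]
  · filter_upwards [hK, hpos] with x hx hx0
    rw [norm_mul, norm_mul, norm_pow, Real.norm_of_nonneg hx0.le, Real.norm_eq_abs,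
      Real.norm_eq_abs]
    calc |φ x| * |θ x| * w x ^ 2 = |θ x| * w x * (|φ x| * w x) := by ring
      _ ≤ K * (|φ x| * w x) := by gcongr

/-- A function whose pairing with `X` is bounded by `K` is bounded by `K` in `X^*`. -/
theorem ae_le_of_pairing_le [IsFiniteMeasure ((volume : Measure (E d)).restrict Ω)]
    (hw : Measurable w)
    (hpos : ∀ᵐ x ∂(volume.restrict Ω), 0 < w x) {θ : E d → ℝ}
    (hθ : AEMeasurable θ (volume.restrict Ω)) {K : ℝ} (hK : 0 ≤ K)
    (h : ∀ φ : X Ω w, pairing φ θ ≤ K * ‖φ‖) : ∀ᵐ x ∂(volume.restrict Ω), |θ x| * w x ≤ K := by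
  obtain ⟨g, hg, hθg⟩ := hθ
  -- The cut-off at R keeps |g| w integrable on the set where the bound K fails.
  have key : ∀ R : ℕ, ∀ᵐ x ∂(volume.restrict Ω), ¬ (K < |g x| * w x ∧ |g x| * w x ≤ R) := by
    intro R
    set B : Set (E d) := {x | K < |g x| * w x ∧ |g x| * w x ≤ R} with hB
    have hgw : Measurable fun x => |g x| * w x := by fun_prop
    have hBm : MeasurableSet B :=
      (measurableSet_lt measurable_const hgw).inter (measurableSet_le hgw measurable_const)
    -- This is sign(g) / w on B. Testing against it gives ∫_B |g| w ≤ K |B|, although |g| w > K on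
    -- B; hence B is null.
    set η : E d → ℝ := B.indicator fun x => g x / (|g x| * w x) with hη
    have hηm : Measurable η := (hg.div hgw).indicator hBm
    have hηw : ∀ᵐ x ∂(volume.restrict Ω), |η x| * w x = B.indicator (fun _ => (1 : ℝ)) x := by
      filter_upwards [hpos] with x hx0
      by_cases hx : x ∈ B
      · have h1 : 0 < |g x| := by
          have := hK.trans_lt hx.1
          exact pos_of_mul_pos_left this hx0.le
        rw [hη, indicator_of_mem hx, indicator_of_mem hx, abs_div, abs_mul, abs_abs,
          abs_of_pos hx0]
        field_simp
      · rw [hη, indicator_of_notMem hx, indicator_of_notMem hx, abs_zero, zero_mul]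
    have hηi : Integrable (fun x => η x * w x) (volume.restrict Ω) := by
      refine Integrable.of_bound (hηm.mul hw).aestronglyMeasurable 1 ?_
      filter_upwards [hηw, hpos] with x hx hx0
      rw [norm_mul, Real.norm_of_nonneg hx0.le, Real.norm_eq_abs, hx]
      exact indicator_le_self' (fun _ _ => zero_le_one) x
    obtain ⟨φ, hφ, hnorm⟩ := exists_X_of_integrable hw hpos hηi
    have h1 := h φ
    have hI : Integrable (B.indicator fun x => |g x| * w x) (volume.restrict Ω) := by
      refine Integrable.of_bound (hgw.indicator hBm).aestronglyMeasurable (R : ℝ) ?_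
      filter_upwards [hpos] with x hx0
      by_cases hx : x ∈ B
      · rw [indicator_of_mem hx, Real.norm_of_nonneg (by positivity)]
        exact hx.2
      · rw [indicator_of_notMem hx, norm_zero]
        positivity
    have h2 : pairing φ θ = ∫ x in Ω, B.indicator (fun x => |g x| * w x) x := by
      refine integral_congr_ae ?_
      filter_upwards [hφ, hθg, hpos] with x h3 h4 h5
      rw [h3, h4]
      by_cases hx : x ∈ B
      · rw [hη, indicator_of_mem hx, indicator_of_mem hx]
        have h1 : 0 < |g x| := pos_of_mul_pos_left (hK.trans_lt hx.1) h5.le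
        have h2 : g x ^ 2 = |g x| ^ 2 := (sq_abs _).symm
        field_simp
        rw [h2]
      · rw [hη, indicator_of_notMem hx, indicator_of_notMem hx, zero_mul, zero_mul]
    have h3 : K * ‖φ‖ = ∫ x in Ω, B.indicator (fun _ => K) x := by
      rw [hnorm, integral_congr_ae hηw, ← integral_const_mul]
      refine integral_congr_ae (Eventually.of_forall fun x => ?_)
      by_cases hx : x ∈ B
      · simp [indicator_of_mem hx]
      · simp [indicator_of_notMem hx]
    have hI2 : Integrable (B.indicator fun _ => K) (volume.restrict Ω) :=
      (integrable_const K).indicator hBm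
    have h4 : 0 ≤ᵐ[volume.restrict Ω] fun x => B.indicator (fun x => |g x| * w x) x -
        B.indicator (fun _ => K) x := by
      refine Eventually.of_forall fun x => ?_
      by_cases hx : x ∈ B
      · simp only [indicator_of_mem hx]
        exact sub_nonneg.2 hx.1.le
      · simp only [indicator_of_notMem hx, sub_zero]
        exact le_rfl
    have h5 : ∫ x in Ω, (B.indicator (fun x => |g x| * w x) x - B.indicator (fun _ => K) x) = 0 := by
      refine le_antisymm ?_ (integral_nonneg_of_ae h4)
      rw [integral_sub hI hI2, ← h2, ← h3]
      exact sub_nonpos.2 h1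
    filter_upwards [(integral_eq_zero_iff_of_nonneg_ae h4 (hI.sub hI2)).1 h5] with x hx hxB
    have hxB : x ∈ B := hxB
    simp only [indicator_of_mem hxB, Pi.zero_apply] at hx
    have := hxB.1
    linarith
  filter_upwards [ae_all_iff.2 key, hθg] with x hx hxg
  rw [hxg]
  by_contra hlt
  obtain ⟨R, hR⟩ := exists_nat_ge (|g x| * w x)
  exact hx R ⟨not_le.1 hlt, hR⟩

theorem XDual.aemeasurable (hw : Measurable w) (hpos : ∀ᵐ x ∂(volume.restrict Ω), 0 < w x)
    (ψ : XDual Ω w) : AEMeasurable (ψ : E d → ℝ) (volume.restrict Ω) := by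
  have h : MemLp (fun x => (ψ : E d → ℝ) x * w x) ⊤ (volume.restrict Ω) := ψ.2
  refine (h.1.aemeasurable.div hw.aemeasurable).congr ?_
  filter_upwards [hpos] with x hx
  exact mul_div_cancel_right₀ _ hx.ne'

theorem XDual.exists_bound (hpos : ∀ᵐ x ∂(volume.restrict Ω), 0 < w x)
    (ψ : XDual Ω w) : ∃ K : ℝ, 0 ≤ K ∧
      ∀ᵐ x ∂(volume.restrict Ω), |(ψ : E d → ℝ) x| * w x ≤ K := by
  have h : MemLp (fun x => (ψ : E d → ℝ) x * w x) ⊤ (volume.restrict Ω) := ψ.2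
  refine ⟨(eLpNormEssSup (fun x => (ψ : E d → ℝ) x * w x) (volume.restrict Ω)).toReal,
    ENNReal.toReal_nonneg, ?_⟩
  filter_upwards [ae_le_eLpNormEssSup (f := fun x => (ψ : E d → ℝ) x * w x)
    (μ := volume.restrict Ω), hpos] with x hx hx0
  have h2 := h.2
  rw [eLpNorm_exponent_top] at h2
  have := ENNReal.toReal_mono h2.ne hx
  rwa [toReal_enorm, norm_mul, Real.norm_of_nonneg hx0.le] at this

theorem mem_XDual_of_bound [IsFiniteMeasure ((volume : Measure (E d)).restrict Ω)]
    (hw : Measurable w) (hpos : ∀ᵐ x ∂(volume.restrict Ω), 0 < w x)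
    {θ : E d → ℝ} (hθ : AEMeasurable θ (volume.restrict Ω)) {K : ℝ}
    (hK : ∀ᵐ x ∂(volume.restrict Ω), |θ x| * w x ≤ K) : θ ∈ XDual Ω w := by
  refine MemLp.of_bound (hθ.mul hw.aemeasurable).aestronglyMeasurable K ?_
  filter_upwards [hK, hpos] with x hx hx0
  rwa [norm_mul, Real.norm_of_nonneg hx0.le]

end Weighted

/-! ### Continuity, semigroup law and joint measurability of the flow -/

section Flow

variable {f : E d → E d} {Φ : ℝ → E d → E d}

theorem IsForwardFlow.continuousOn_time (hΦ : IsForwardFlow Ω f Φ) {x : E d}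
    (hx : x ∈ closure Ω) : ContinuousOn (fun t => Φ t x) (Ici 0) :=
  fun t ht => (hΦ.deriv x hx t ht).continuousWithinAt

/-- Grönwall's inequality, with f Lipschitz on a closed ball containing the closure of Ω. Arbitrary
trajectories are allowed so that one estimate yields both continuity in the initial point and, by
uniqueness, the semigroup law. -/
theorem exists_dist_trajectories_le (hΩ : Bornology.IsBounded Ω) (hf : ContDiff ℝ 1 f) : ∃ K : NNReal, ∀ γ₁ γ₂ : ℝ → E d,
      (∀ t, 0 ≤ t → γ₁ t ∈ closure Ω) → (∀ t, 0 ≤ t → γ₂ t ∈ closure Ω) →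
      (∀ t, 0 ≤ t → HasDerivWithinAt γ₁ (f (γ₁ t)) (Ici 0) t) →
      (∀ t, 0 ≤ t → HasDerivWithinAt γ₂ (f (γ₂ t)) (Ici 0) t) →
      ∀ t, 0 ≤ t → dist (γ₁ t) (γ₂ t) ≤ dist (γ₁ 0) (γ₂ 0) * Real.exp (K * t) := by
  obtain ⟨R, hR⟩ := hΩ.subset_closedBall 0
  have hcl : closure Ω ⊆ Metric.closedBall 0 R := closure_minimal hR Metric.isClosed_closedBall
  obtain ⟨K, hK⟩ := hf.contDiffOn.exists_lipschitzOnWith one_ne_zero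
    (convex_closedBall (0 : E d) R) (isCompact_closedBall 0 R)
  refine ⟨K, fun γ₁ γ₂ h1 h2 hd1 hd2 t ht => ?_⟩
  have hmono : ∀ {γ : ℝ → E d} {s v}, 0 ≤ s → HasDerivWithinAt γ v (Ici 0) s →
      HasDerivWithinAt γ v (Ici s) s := fun hs h => h.mono (Ici_subset_Ici.2 hs)
  have := dist_le_of_trajectories_ODE_of_mem (v := fun _ => f)
    (s := fun _ => Metric.closedBall (0 : E d) R) (K := K) (a := 0) (b := t) (f := γ₁) (g := γ₂)
    (fun _ _ => hK)
    (fun s hs => (hd1 s hs.1).continuousWithinAt.mono Icc_subset_Ici_self)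
    (fun s hs => hmono hs.1 (hd1 s hs.1)) (fun s hs => hcl (h1 s hs.1))
    (fun s hs => (hd2 s hs.1).continuousWithinAt.mono Icc_subset_Ici_self)
    (fun s hs => hmono hs.1 (hd2 s hs.1)) (fun s hs => hcl (h2 s hs.1)) le_rfl t ⟨ht, le_rfl⟩
  rwa [sub_zero] at this

theorem IsForwardFlow.continuousOn_space (hΩ : Bornology.IsBounded Ω) (hf : ContDiff ℝ 1 f)
    (hΦ : IsForwardFlow Ω f Φ) {t : ℝ} (ht : 0 ≤ t) : ContinuousOn (Φ t) (closure Ω) := by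
  obtain ⟨K, hK⟩ := exists_dist_trajectories_le hΩ hf
  have hL : LipschitzOnWith (Real.toNNReal (Real.exp (K * t))) (Φ t) (closure Ω) := by
    refine LipschitzOnWith.of_dist_le_mul fun x hx y hy => ?_
    rw [Real.coe_toNNReal _ (Real.exp_pos _).le]
    have := hK (fun s => Φ s x) (fun s => Φ s y) (hΦ.invariant x hx) (hΦ.invariant y hy)
      (hΦ.deriv x hx) (hΦ.deriv y hy) t ht
    rwa [hΦ.initial x hx, hΦ.initial y hy, mul_comm] at this
  exact hL.continuousOn

theorem IsForwardFlow.map_add (hΩ : Bornology.IsBounded Ω) (hf : ContDiff ℝ 1 f)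
    (hΦ : IsForwardFlow Ω f Φ) {x : E d} (hx : x ∈ closure Ω) {t s : ℝ} (ht : 0 ≤ t)
    (hs : 0 ≤ s) : Φ s (Φ t x) = Φ (t + s) x := by
  obtain ⟨K, hK⟩ := exists_dist_trajectories_le hΩ hf
  have hx' := hΦ.invariant x hx t ht
  have := hK (fun s => Φ s (Φ t x)) (fun s => Φ (t + s) x) (hΦ.invariant _ hx')
    (fun s hs => hΦ.invariant x hx _ (add_nonneg ht hs)) (hΦ.deriv _ hx') (fun s hs => by
      have h1 := hΦ.deriv x hx (t + s) (add_nonneg ht hs)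
      have h2 : HasDerivWithinAt (fun s => t + s) (1 : ℝ) (Ici 0) s :=
        (hasDerivWithinAt_id s _).const_add t
      have := HasDerivWithinAt.scomp s h1 h2 fun r hr => add_nonneg ht hr
      rwa [one_smul] at this) s hs
  simp only [hΦ.initial _ hx', add_zero, dist_self, zero_mul] at this
  exact dist_le_zero.1 this

/-- A jointly measurable extension of the flow. -/
def flowExt (Ω : Set (E d)) (Φ : ℝ → E d → E d) (t : ℝ) (x : E d) : E d := by
  classical exact if x ∈ closure Ω then Φ (max t 0) x else 0

theorem flowExt_eq {t : ℝ} (ht : 0 ≤ t) {x : E d} (hx : x ∈ closure Ω) :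
    flowExt Ω Φ t x = Φ t x := by
  rw [flowExt, if_pos hx, max_eq_left ht]

/-- A Carathéodory argument: the extension is continuous in time and measurable in space. -/
theorem measurable_flowExt (hΩ : Bornology.IsBounded Ω) (hf : ContDiff ℝ 1 f)
    (hΦ : IsForwardFlow Ω f Φ) : Measurable (Function.uncurry (flowExt Ω Φ)) := by
  refine measurable_uncurry_of_continuous_of_measurable (fun x => ?_) fun t => ?_
  · by_cases hx : x ∈ closure Ω
    · simp only [flowExt, if_pos hx]
      exact (hΦ.continuousOn_time hx).comp_continuous (by fun_prop) fun t => le_max_right t 0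
    · simp only [flowExt, if_neg hx]
      exact continuous_const
  · classical
    have h := (hΦ.continuousOn_space hΩ hf (le_max_right t 0)).measurable_piecewise
      (g := fun _ => (0 : E d)) continuousOn_const isClosed_closure.measurableSet
    have he : flowExt Ω Φ t = (closure Ω).piecewise (Φ (max t 0)) fun _ => (0 : E d) := by
      ext1 x
      simp only [flowExt, piecewise]
    rw [he]
    exact h

end Flow

/-! ### The composition semigroup and its orbits -/

variable {f : E d → E d} {Φ : ℝ → E d → E d} {S : ℝ → X Ω w →L[ℝ] X Ω w}

theorem StandingAssumptions.isFiniteMeasure (hstd : StandingAssumptions Ω f w Φ) :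
    IsFiniteMeasure ((volume : Measure (E d)).restrict Ω) :=
  ⟨by rw [Measure.restrict_apply_univ]; exact hstd.bounded.measure_lt_top⟩

theorem StandingAssumptions.mem_closure (hstd : StandingAssumptions Ω f w Φ) :
    ∀ᵐ x ∂(volume.restrict Ω), x ∈ closure Ω := by
  filter_upwards [ae_restrict_mem hstd.isOpen.measurableSet] with x hx using subset_closure hx

theorem StandingAssumptions.flowExt_ae (hstd : StandingAssumptions Ω f w Φ) {t : ℝ}
    (ht : 0 ≤ t) : ∀ᵐ x ∂(volume.restrict Ω), flowExt Ω Φ t x = Φ t x := by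
  filter_upwards [hstd.mem_closure] with x hx using flowExt_eq ht hx

theorem StandingAssumptions.measurable_flowExt (hstd : StandingAssumptions Ω f w Φ) :
    Measurable (Function.uncurry (flowExt Ω Φ)) :=
  KoopmanLyapunov.measurable_flowExt hstd.bounded hstd.smooth hstd.flow

theorem StandingAssumptions.pairing_le_of_bound (hstd : StandingAssumptions Ω f w Φ)
    (hS : IsPreadjoint Φ S) {t : ℝ} (ht : 0 ≤ t) (ψ : XDual Ω w) {K : ℝ} (hK0 : 0 ≤ K)
    (hK : ∀ᵐ x ∂(volume.restrict Ω), |(ψ : E d → ℝ) x| * w x ≤ K) (φ : X Ω w) :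
    |pairing φ (koopman Φ t ψ)| ≤ K * ‖S t‖ * ‖φ‖ := by
  rw [← hS t ht]
  refine (abs_pairing_le hstd.weight_measurable hstd.weight_pos _ hK).trans ?_
  rw [mul_assoc]
  exact mul_le_mul_of_nonneg_left ((S t).le_opNorm φ) hK0

/-- The flow maps are nonsingular, as the composition operators have a preadjoint. -/
theorem StandingAssumptions.ae_flow (hstd : StandingAssumptions Ω f w Φ) (hS : IsPreadjoint Φ S)
    {t : ℝ} (ht : 0 ≤ t) {P : E d → Prop} (hP : ∀ᵐ z ∂(volume.restrict Ω), P z) :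
    ∀ᵐ x ∂(volume.restrict Ω), P (Φ t x) := by
  have := hstd.isFiniteMeasure
  set N := toMeasurable (volume.restrict Ω) {z | ¬ P z} with hN
  have hNm : MeasurableSet N := measurableSet_toMeasurable _ _
  have hN0 : ∀ᵐ z ∂(volume.restrict Ω), z ∉ N := by
    rw [ae_iff]
    simp only [not_not, ofPred_mem_eq, hN, measure_toMeasurable]
    exact hP
  -- The indicator of a null set is zero as an element of the dual. By the preadjoint identity its
  -- composition with the flow pairs to zero with every φ, hence vanishes a.e.: almost no point is
  -- carried into N.
  set b : E d → ℝ := N.indicator 1 with hb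
  have hbm : Measurable b := measurable_one.indicator hNm
  have hb0 : ∀ᵐ z ∂(volume.restrict Ω), |b z| * w z ≤ 0 := by
    filter_upwards [hN0] with z hz
    rw [hb, indicator_of_notMem hz, abs_zero, zero_mul]
  let ψ : XDual Ω w := ⟨b, mem_XDual_of_bound hstd.weight_measurable hstd.weight_pos
    hbm.aemeasurable hb0⟩
  have hθ : AEMeasurable (koopman Φ t b) (volume.restrict Ω) := by
    refine AEMeasurable.congr (f := fun x => b (flowExt Ω Φ t x)) ?_ ?_
    · exact (hbm.comp (hstd.measurable_flowExt.comp measurable_prodMk_left)).aemeasurable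
    · filter_upwards [hstd.flowExt_ae ht] with x hx
      rw [hx, koopman]
  have h := ae_le_of_pairing_le hstd.weight_measurable hstd.weight_pos hθ le_rfl fun φ => by
    have := hstd.pairing_le_of_bound hS ht ψ le_rfl hb0 φ
    rw [zero_mul, zero_mul] at this
    rw [zero_mul]
    exact (le_abs_self _).trans this
  filter_upwards [h, hstd.weight_pos] with x hx hx0
  by_contra hPx
  have hmem : Φ t x ∈ N := subset_toMeasurable _ _ hPx
  rw [koopman, hb, indicator_of_mem hmem, Pi.one_apply, abs_one, one_mul] at hx
  linarith

/-- `y` is a jointly measurable version of `(t, x) ↦ ψ (Φ t x)`. -/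
structure IsOrbitVersion (Ω : Set (E d)) (Φ : ℝ → E d → E d) (ψ : E d → ℝ)
    (y : ℝ → E d → ℝ) : Prop where
  meas : Measurable (Function.uncurry y)
  ae_eq : ∀ t, 0 ≤ t → y t =ᵐ[volume.restrict Ω] koopman Φ t ψ

/-- Compose a measurable representative of ψ with the jointly measurable extension of the flow.
Nonsingularity of the flow maps ensures that changing the representative is harmless at each fixed
time. -/
theorem StandingAssumptions.exists_isOrbitVersion (hstd : StandingAssumptions Ω f w Φ)
    (hS : IsPreadjoint Φ S) (ψ : XDual Ω w) : ∃ y, IsOrbitVersion Ω Φ ψ y := by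
  have hψ := XDual.aemeasurable hstd.weight_measurable hstd.weight_pos ψ
  refine ⟨fun t x => hψ.mk _ (flowExt Ω Φ t x), hψ.measurable_mk.comp hstd.measurable_flowExt,
    fun t ht => ?_⟩
  filter_upwards [hstd.flowExt_ae ht, hstd.ae_flow hS ht hψ.ae_eq_mk] with x h1 h2
  rw [h1, koopman, h2]

theorem IsOrbitVersion.measurable_apply {ψ : E d → ℝ} {y : ℝ → E d → ℝ}
    (hy : IsOrbitVersion Ω Φ ψ y) (t : ℝ) : Measurable (y t) :=
  hy.meas.comp measurable_prodMk_left

theorem IsOrbitVersion.measurable_orbit {ψ : E d → ℝ} {y : ℝ → E d → ℝ}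
    (hy : IsOrbitVersion Ω Φ ψ y) (x : E d) : Measurable fun t => y t x :=
  hy.meas.comp measurable_prodMk_right

theorem IsOrbitVersion.pairing_eq {ψ : XDual Ω w} {y : ℝ → E d → ℝ}
    (hy : IsOrbitVersion Ω Φ ψ y) (hS : IsPreadjoint Φ S) {t : ℝ} (ht : 0 ≤ t) (φ : X Ω w) :
    pairing φ (y t) = pairing (S t φ) ψ := by
  rw [hS t ht, pairing_congr (hy.ae_eq t ht)]

theorem StandingAssumptions.aemeasurable_koopman (hstd : StandingAssumptions Ω f w Φ)
    (hS : IsPreadjoint Φ S) {t : ℝ} (ht : 0 ≤ t) (ψ : XDual Ω w) :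
    AEMeasurable (koopman Φ t ψ) (volume.restrict Ω) := by
  obtain ⟨y, hy⟩ := hstd.exists_isOrbitVersion hS ψ
  exact (hy.measurable_apply t).aemeasurable.congr (hy.ae_eq t ht)

/-- The operator norm of the preadjoint bounds all pairings, and duality turns that into an
essential bound. -/
theorem StandingAssumptions.koopman_bound (hstd : StandingAssumptions Ω f w Φ)
    (hS : IsPreadjoint Φ S) {t : ℝ} (ht : 0 ≤ t) (ψ : XDual Ω w) {K : ℝ} (hK0 : 0 ≤ K)
    (hK : ∀ᵐ x ∂(volume.restrict Ω), |(ψ : E d → ℝ) x| * w x ≤ K) :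
    ∀ᵐ x ∂(volume.restrict Ω), |koopman Φ t ψ x| * w x ≤ K * ‖S t‖ := by
  have := hstd.isFiniteMeasure
  exact ae_le_of_pairing_le hstd.weight_measurable hstd.weight_pos
    (hstd.aemeasurable_koopman hS ht ψ) (by positivity) fun φ =>
      (le_abs_self _).trans (hstd.pairing_le_of_bound hS ht ψ hK0 hK φ)

theorem StandingAssumptions.koopman_mem (hstd : StandingAssumptions Ω f w Φ)
    (hS : IsPreadjoint Φ S) {t : ℝ} (ht : 0 ≤ t) (ψ : XDual Ω w) :
    koopman Φ t ψ ∈ XDual Ω w := by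
  have := hstd.isFiniteMeasure
  obtain ⟨K, hK0, hK⟩ := XDual.exists_bound hstd.weight_pos ψ
  exact mem_XDual_of_bound hstd.weight_measurable hstd.weight_pos
    (hstd.aemeasurable_koopman hS ht ψ) (hstd.koopman_bound hS ht ψ hK0 hK)

/-- A weak form of the semigroup law for S, which is known only through duality; it is inherited
from the flow. -/
theorem StandingAssumptions.pairing_add (hstd : StandingAssumptions Ω f w Φ)
    (hS : IsPreadjoint Φ S) {t h : ℝ} (ht : 0 ≤ t) (hh : 0 ≤ h) (φ : X Ω w) (ψ : XDual Ω w) :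
    pairing (S (t + h) φ) ψ = pairing (S t φ) (koopman Φ h ψ) := by
  rw [hS _ (add_nonneg ht hh), hS t ht φ ⟨_, hstd.koopman_mem hS hh ψ⟩]
  refine pairing_congr ?_
  filter_upwards [hstd.mem_closure] with x hx
  simp only [koopman, hstd.flow.map_add hstd.bounded hstd.smooth hx ht hh]

theorem IsOrbitVersion.exists_bound (hstd : StandingAssumptions Ω f w Φ) (hS : IsPreadjoint Φ S)
    {ω₀ : ℝ} (hst : ExponentiallyStable S ω₀) {ψ : XDual Ω w} {y : ℝ → E d → ℝ}
    (hy : IsOrbitVersion Ω Φ ψ y) : ∃ K, 0 ≤ K ∧ ∀ t, 0 ≤ t →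
      ∀ᵐ x ∂(volume.restrict Ω), |y t x| * w x ≤ K * Real.exp (ω₀ * t) := by
  obtain ⟨-, M, hM⟩ := hst
  have hM0 : 0 ≤ M := by simpa using (norm_nonneg _).trans (hM 0 le_rfl)
  obtain ⟨K, hK0, hK⟩ := XDual.exists_bound hstd.weight_pos ψ
  refine ⟨K * M, by positivity, fun t ht => ?_⟩
  filter_upwards [hy.ae_eq t ht, hstd.koopman_bound hS ht ψ hK0 hK] with x h1 h2
  rw [h1, mul_assoc]
  exact h2.trans (mul_le_mul_of_nonneg_left (hM t ht) hK0)

theorem IsOrbitVersion.measurable_pairing {ψ : E d → ℝ} {y : ℝ → E d → ℝ}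
    (hw : Measurable w)
    (hy : IsOrbitVersion Ω Φ ψ y) (φ : X Ω w) : StronglyMeasurable fun t => pairing φ (y t) := by
  refine StronglyMeasurable.integral_prod_right
    (f := fun t x => φ x * y t x * w x ^ 2) ?_
  refine Measurable.stronglyMeasurable ?_
  have h1 : Measurable fun p : ℝ × E d => φ p.2 :=
    (Lp.stronglyMeasurable φ).measurable.comp measurable_snd
  have h2 : Measurable fun p : ℝ × E d => y p.1 p.2 := hy.meas
  have h3 : Measurable fun p : ℝ × E d => w p.2 := hw.comp measurable_snd
  exact (h1.mul h2).mul (h3.pow_const 2)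

/-- Weak-* integrals `∫ ρ(s) S^*(s) ψ ds`. -/
theorem IsOrbitVersion.pairing_integral (hstd : StandingAssumptions Ω f w Φ)
    {ω₀ : ℝ} {ψ : E d → ℝ} {y : ℝ → E d → ℝ}
    (hy : IsOrbitVersion Ω Φ ψ y) {K : ℝ} (hK : ∀ t, 0 ≤ t →
      ∀ᵐ x ∂(volume.restrict Ω), |y t x| * w x ≤ K * Real.exp (ω₀ * t))
    {ρ : ℝ → ℝ} (hρm : Measurable ρ)
    (hρ : Integrable (fun s => ρ s * Real.exp (ω₀ * s)) halfLine) (φ : X Ω w) :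
    Integrable (fun x => φ x * (∫ s, ρ s * y s x ∂halfLine) * w x ^ 2) (volume.restrict Ω) ∧
    pairing φ (fun x => ∫ s, ρ s * y s x ∂halfLine) = ∫ s, ρ s * pairing φ (y s) ∂halfLine := by
  have := hstd.isFiniteMeasure
  have hw := hstd.weight_measurable
  have hmeas : Measurable fun p : E d × ℝ => φ p.1 * (ρ p.2 * y p.2 p.1) * w p.1 ^ 2 := by
    have h1 : Measurable fun p : E d × ℝ => φ p.1 :=
      (Lp.stronglyMeasurable φ).measurable.comp measurable_fst
    have h2 : Measurable fun p : E d × ℝ => y p.2 p.1 := hy.meas.comp measurable_swap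
    exact (h1.mul ((hρm.comp measurable_snd).mul h2)).mul
      ((hw.comp measurable_fst).pow_const 2)
  have hbd : ∀ᵐ p ∂((volume.restrict Ω).prod halfLine),
      |y p.2 p.1| * w p.1 ≤ K * Real.exp (ω₀ * p.2) := by
    have hset : MeasurableSet {p : E d × ℝ | |y p.2 p.1| * w p.1 ≤ K * Real.exp (ω₀ * p.2)} := by
      have h2 : Measurable fun p : E d × ℝ => y p.2 p.1 := hy.meas.comp measurable_swap
      exact measurableSet_le (h2.abs.mul (hw.comp measurable_fst)) (by fun_prop)
    rw [Measure.ae_prod_iff_ae_ae hset, Measure.ae_ae_comm hset]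
    filter_upwards [ae_restrict_mem measurableSet_Ioi] with t ht using hK t (le_of_lt ht)
  have hpos : ∀ᵐ p ∂((volume.restrict Ω).prod halfLine), 0 < w p.1 :=
    Measure.quasiMeasurePreserving_fst.ae hstd.weight_pos
  have hint : Integrable (fun p : E d × ℝ => φ p.1 * (ρ p.2 * y p.2 p.1) * w p.1 ^ 2)
      ((volume.restrict Ω).prod halfLine) := by
    have hg := ((X.integrable hw hstd.weight_pos φ).mul_prod hρ).norm.const_mul K
    refine hg.mono' hmeas.aestronglyMeasurable ?_
    filter_upwards [hbd, hpos] with p h1 h2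
    rw [norm_mul, norm_mul, norm_mul, norm_mul, norm_mul, norm_mul, norm_pow,
      Real.norm_of_nonneg h2.le, Real.norm_of_nonneg (Real.exp_pos _).le, Real.norm_eq_abs (y _ _)]
    calc ‖φ p.1‖ * (‖ρ p.2‖ * |y p.2 p.1|) * w p.1 ^ 2
        = ‖φ p.1‖ * w p.1 * ‖ρ p.2‖ * (|y p.2 p.1| * w p.1) := by ring
      _ ≤ ‖φ p.1‖ * w p.1 * ‖ρ p.2‖ * (K * Real.exp (ω₀ * p.2)) := by gcongr
      _ = _ := by ring
  have heq : ∀ x, ∫ s, φ x * (ρ s * y s x) * w x ^ 2 ∂halfLine =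
      φ x * (∫ s, ρ s * y s x ∂halfLine) * w x ^ 2 := fun x => by
    rw [integral_mul_const, integral_const_mul]
  constructor
  · refine hint.integral_prod_left.congr (Eventually.of_forall heq)
  · have h1 : pairing φ (fun x => ∫ s, ρ s * y s x ∂halfLine) =
        ∫ x in Ω, ∫ s, φ x * (ρ s * y s x) * w x ^ 2 ∂halfLine := by
      simp only [heq, pairing]
    rw [h1, integral_integral_swap hint]
    refine integral_congr_ae (Eventually.of_forall fun s => ?_)
    simp only [pairing]
    rw [← integral_const_mul]
    refine integral_congr_ae (Eventually.of_forall fun x => ?_)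
    show φ x * (ρ s * y s x) * w x ^ 2 = ρ s * (φ x * y s x * w x ^ 2)
    ring

/-! ### From the weak-* generator to integral identities along orbits -/

theorem pairing_add_left (hw : Measurable w) (hpos : ∀ᵐ x ∂(volume.restrict Ω), 0 < w x)
    (ψ : XDual Ω w) (φ₁ φ₂ : X Ω w) :
    pairing (φ₁ + φ₂) ψ = pairing φ₁ ψ + pairing φ₂ ψ := by
  obtain ⟨K, -, hK⟩ := XDual.exists_bound hpos ψ
  have hm := XDual.aemeasurable hw hpos ψ
  rw [pairing, pairing, pairing, ← integral_add (integrable_pairing hw hpos φ₁ hm hK)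
    (integrable_pairing hw hpos φ₂ hm hK)]
  refine integral_congr_ae ?_
  filter_upwards [(absolutelyContinuous_weightedMeasure hw hpos).ae_le (Lp.coeFn_add φ₁ φ₂)]
    with x hx
  rw [hx, Pi.add_apply]
  ring

theorem pairing_smul_left (hw : Measurable w) (hpos : ∀ᵐ x ∂(volume.restrict Ω), 0 < w x)
    (ψ : E d → ℝ) (a : ℝ) (φ : X Ω w) : pairing (a • φ) ψ = a * pairing φ ψ := by
  rw [pairing, pairing, ← integral_const_mul]
  refine integral_congr_ae ?_
  filter_upwards [(absolutelyContinuous_weightedMeasure hw hpos).ae_le (Lp.coeFn_smul a φ)]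
    with x hx
  rw [hx, Pi.smul_apply, smul_eq_mul]
  ring

/-- The functional `⟨·, ψ⟩` on `X`. -/
theorem exists_pairing_clm (hw : Measurable w) (hpos : ∀ᵐ x ∂(volume.restrict Ω), 0 < w x)
    (ψ : XDual Ω w) : ∃ L : X Ω w →L[ℝ] ℝ, ∀ φ, L φ = pairing φ ψ := by
  obtain ⟨K, -, hK⟩ := XDual.exists_bound hpos ψ
  exact ⟨LinearMap.mkContinuous
    { toFun := fun φ => pairing φ ψ
      map_add' := pairing_add_left hw hpos ψ
      map_smul' := pairing_smul_left hw hpos ψ } K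
    fun φ => abs_pairing_le hw hpos φ hK, fun φ => rfl⟩

/-- Elements of the domain of the generator are Lipschitz along the semigroup. -/
theorem IsGeneratorValue.exists_lipschitz (hstd : StandingAssumptions Ω f w Φ)
    (hS : IsPreadjoint Φ S) {ω₀ : ℝ} (hst : ExponentiallyStable S ω₀) {ψ η : XDual Ω w}
    (h : IsGeneratorValue Φ ψ η) : ∃ C : ℝ, 0 ≤ C ∧ ∀ (φ : X Ω w) (t : ℝ), 0 < t →
      |pairing φ (koopman Φ t ψ) - pairing φ ψ| ≤ C * t * ‖φ‖ := by
  have hw := hstd.weight_measurable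
  have hpos := hstd.weight_pos
  obtain ⟨hω, M, hM⟩ := hst
  have hM0 : 0 ≤ M := by simpa using (norm_nonneg _).trans (hM 0 le_rfl)
  obtain ⟨K, hK0, hK⟩ := XDual.exists_bound hpos ψ
  obtain ⟨L₀, hL₀⟩ := exists_pairing_clm hw hpos ψ
  choose L hL using fun t : Ioi (0 : ℝ) =>
    exists_pairing_clm hw hpos ⟨_, hstd.koopman_mem hS (le_of_lt t.2) ψ⟩
  let g : Ioi (0 : ℝ) → X Ω w →L[ℝ] ℝ := fun t => (t : ℝ)⁻¹ • (L t - L₀)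
  have hg : ∀ t φ, g t φ = (pairing φ (koopman Φ t ψ) - pairing φ ψ) / t := fun t φ => by
    show (t : ℝ)⁻¹ • (L t φ - L₀ φ) = _
    rw [hL, hL₀, smul_eq_mul, div_eq_inv_mul]
  -- Difference quotients are pointwise bounded: for t < δ by convergence to ⟨φ, η⟩, for t ≥ δ by
  -- boundedness of the semigroup and division by δ. Uniform boundedness gives C.
  obtain ⟨C, hC⟩ := banach_steinhaus (g := g) fun φ => by
    have h1 : ∀ᶠ t in 𝓝[>] (0 : ℝ), |(pairing φ (koopman Φ t ψ) - pairing φ ψ) / t| ≤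
        |pairing φ η| + 1 :=
      ((h φ).abs.eventually (eventually_lt_nhds (lt_add_one _))).mono fun t ht => ht.le
    obtain ⟨δ, hδ, hδ'⟩ := mem_nhdsGT_iff_exists_Ioo_subset.1 h1
    refine ⟨max (|pairing φ η| + 1) ((K * M * ‖φ‖ + K * ‖φ‖) / δ), fun t => ?_⟩
    rw [hg, Real.norm_eq_abs]
    by_cases ht : (t : ℝ) < δ
    · exact le_max_of_le_left (hδ' ⟨t.2, ht⟩)
    · refine le_max_of_le_right ?_
      have ht0 : (0 : ℝ) < t := t.2
      rw [abs_div, abs_of_pos ht0]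
      have h2 := hstd.pairing_le_of_bound hS ht0.le ψ hK0 hK φ
      have h3 := abs_pairing_le hw hpos φ hK
      have h4 : ‖S t‖ ≤ M := (hM t ht0.le).trans (mul_le_of_le_one_right hM0
        (Real.exp_le_one_iff.2 (mul_nonpos_of_nonpos_of_nonneg hω.le ht0.le)))
      refine div_le_div₀ (by positivity) ?_ hδ (not_lt.1 ht)
      refine (abs_sub _ _).trans (add_le_add (h2.trans ?_) h3)
      gcongr
  refine ⟨max C 0, le_max_right _ _, fun φ t ht => ?_⟩
  have h1 := ((g ⟨t, ht⟩).le_opNorm φ).trans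
    (mul_le_mul_of_nonneg_right ((hC ⟨t, ht⟩).trans (le_max_left C 0)) (norm_nonneg _))
  rw [hg, Real.norm_eq_abs, abs_div, abs_of_pos ht, div_le_iff₀ ht] at h1
  calc _ ≤ _ := h1
    _ = _ := by ring

theorem IsOrbitVersion.abs_pairing_le (hstd : StandingAssumptions Ω f w Φ)
    (hS : IsPreadjoint Φ S) {ω₀ : ℝ} {ψ : XDual Ω w} {y : ℝ → E d → ℝ}
    (hy : IsOrbitVersion Ω Φ ψ y) {K : ℝ} (hK : ∀ t, 0 ≤ t →
      ∀ᵐ x ∂(volume.restrict Ω), |y t x| * w x ≤ K * Real.exp (ω₀ * t)) (φ : X Ω w) {t : ℝ}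
    (ht : 0 ≤ t) : |pairing (S t φ) ψ| ≤ K * ‖φ‖ * Real.exp (ω₀ * t) := by
  rw [← hy.pairing_eq hS ht]
  refine (KoopmanLyapunov.abs_pairing_le hstd.weight_measurable hstd.weight_pos φ (hK t ht)).trans
    (le_of_eq (by ring))

/-- Testing the generator limit on S(s)φ shows that F(s) = ⟨S(s)φ, ψ⟩ has right derivative ⟨S(s)φ,
η⟩. Since F is Lipschitz, hence continuous, and this derivative is integrable, the fundamental
theorem of calculus holds with a right derivative only; stability sends F to 0 at infinity. -/
theorem IsGeneratorValue.pairing_eq_integral (hstd : StandingAssumptions Ω f w Φ)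
    (hS : IsPreadjoint Φ S) {ω₀ : ℝ} (hst : ExponentiallyStable S ω₀) {ψ η : XDual Ω w}
    (h : IsGeneratorValue Φ ψ η) (φ : X Ω w) {t : ℝ} (ht : 0 ≤ t) :
    pairing (S t φ) ψ = - ∫ s in Ioi t, pairing (S s φ) η := by
  obtain ⟨y, hy⟩ := hstd.exists_isOrbitVersion hS ψ
  obtain ⟨z, hz⟩ := hstd.exists_isOrbitVersion hS η
  obtain ⟨K, hK0, hK⟩ := hy.exists_bound hstd hS hst
  obtain ⟨K', hK0', hK'⟩ := hz.exists_bound hstd hS hst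
  obtain ⟨C, hC0, hC⟩ := h.exists_lipschitz hstd hS hst
  obtain ⟨hω, M, hM⟩ := hst
  have hM0 : 0 ≤ M := by simpa using (norm_nonneg _).trans (hM 0 le_rfl)
  set F : ℝ → ℝ := fun t => pairing (S t φ) ψ with hF
  set D : ℝ → ℝ := fun t => pairing (S t φ) η with hD
  have hlip : ∀ s u, 0 ≤ s → s < u → |F u - F s| ≤ C * M * ‖φ‖ * (u - s) := by
    intro s u hs hsu
    have h1 := hC (S s φ) (u - s) (sub_pos.2 hsu)
    rw [← hstd.pairing_add hS hs (sub_pos.2 hsu).le, add_sub_cancel] at h1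
    refine h1.trans ?_
    have h2 : ‖S s φ‖ ≤ M * ‖φ‖ := ((S s).le_opNorm φ).trans
      (mul_le_mul_of_nonneg_right ((hM s hs).trans (mul_le_of_le_one_right hM0
        (Real.exp_le_one_iff.2 (mul_nonpos_of_nonpos_of_nonneg hω.le hs)))) (norm_nonneg _))
    have h3 := sub_pos.2 hsu
    calc C * (u - s) * ‖S s φ‖ ≤ C * (u - s) * (M * ‖φ‖) := by gcongr
      _ = _ := by ring
  have hcont : ContinuousOn F (Ici 0) := by
    have : LipschitzOnWith (Real.toNNReal (C * M * ‖φ‖)) F (Ici 0) := by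
      refine LipschitzOnWith.of_dist_le_mul fun a ha b hb => ?_
      rw [Real.coe_toNNReal _ (by positivity), Real.dist_eq, Real.dist_eq]
      rcases lt_trichotomy a b with hab | hab | hab
      · rw [abs_sub_comm, abs_sub_comm a b, abs_of_pos (sub_pos.2 hab)]
        exact hlip a b ha hab
      · simp [hab]
      · rw [abs_of_pos (sub_pos.2 hab)]
        exact hlip b a hb hab
    exact this.continuousOn
  have hderiv : ∀ s, 0 ≤ s → HasDerivWithinAt F (D s) (Ioi s) s := by
    intro s hs
    rw [hasDerivWithinAt_iff_tendsto_slope' self_notMem_Ioi]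
    have h1 : Tendsto (fun u => u - s) (𝓝[>] s) (𝓝[>] 0) := by
      refine tendsto_nhdsWithin_iff.2 ⟨?_, ?_⟩
      · have : Tendsto (fun u => u - s) (𝓝 s) (𝓝 (s - s)) := by
          exact (continuous_sub_right s).tendsto s
        rw [sub_self] at this
        exact this.mono_left nhdsWithin_le_nhds
      · filter_upwards [self_mem_nhdsWithin] with u hu using sub_pos.2 (mem_Ioi.1 hu)
    refine ((h (S s φ)).comp h1).congr' ?_
    filter_upwards [self_mem_nhdsWithin] with u hu
    have hu : s < u := hu
    rw [Function.comp, ← hstd.pairing_add hS hs (sub_pos.2 hu).le, add_sub_cancel,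
      slope_def_field]
  have hDint : IntegrableOn D (Ioi 0) := by
    have he : IntegrableOn (fun t => Real.exp (-(-ω₀) * t)) (Ioi 0) :=
      exp_neg_integrableOn_Ioi 0 (neg_pos.2 hω)
    refine (he.const_mul (K' * ‖φ‖)).mono' ?_ ?_
    · refine AEStronglyMeasurable.congr
        (hz.measurable_pairing hstd.weight_measurable φ).aestronglyMeasurable ?_
      filter_upwards [ae_restrict_mem measurableSet_Ioi] with u hu
      exact hz.pairing_eq hS (le_of_lt hu) φ
    · filter_upwards [ae_restrict_mem measurableSet_Ioi] with u hu
      rw [neg_neg]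
      exact hz.abs_pairing_le hstd hS hK' φ (le_of_lt hu)
  have hDt : IntegrableOn D (Ioi t) := hDint.mono_set (Ioi_subset_Ioi ht)
  have hFTC : ∀ u, t ≤ u → ∫ s in t..u, D s = F u - F t := fun u hu => by
    refine intervalIntegral.integral_eq_sub_of_hasDeriv_right_of_le hu
      (hcont.mono fun s hs => ht.trans hs.1) (fun s hs => hderiv s (ht.trans hs.1.le)) ?_
    exact (intervalIntegrable_iff_integrableOn_Ioc_of_le hu).2 (hDt.mono_set Ioc_subset_Ioi_self)
  have hF0 : Tendsto F atTop (𝓝 0) := by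
    have he : Tendsto (fun u => K * ‖φ‖ * Real.exp (ω₀ * u)) atTop (𝓝 0) := by
      have h1 := Real.tendsto_exp_atBot.comp (tendsto_id.const_mul_atTop_of_neg hω)
      simpa using h1.const_mul (K * ‖φ‖)
    refine squeeze_zero_norm' ?_ he
    filter_upwards [eventually_ge_atTop 0] with u hu
    exact hy.abs_pairing_le hstd hS hK φ hu
  have hlim1 := intervalIntegral_tendsto_integral_Ioi t hDt tendsto_id
  have hlim2 : Tendsto (fun u => ∫ s in t..(id u), D s) atTop (𝓝 (0 - F t)) := by
    refine (hF0.sub_const (F t)).congr' ?_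
    filter_upwards [eventually_ge_atTop t] with u hu
    exact (hFTC u hu).symm
  have := tendsto_nhds_unique hlim1 hlim2
  rw [this]
  simp [hF]

/-- The previous identity, valid against every φ, is transferred to almost every point. The
exceptional null set still depends on t. -/
theorem IsGeneratorValue.orbit_eq_integral (hstd : StandingAssumptions Ω f w Φ)
    (hS : IsPreadjoint Φ S) {ω₀ : ℝ} (hst : ExponentiallyStable S ω₀) {ψ η : XDual Ω w}
    (h : IsGeneratorValue Φ ψ η) {y z : ℝ → E d → ℝ} (hy : IsOrbitVersion Ω Φ ψ y)
    (hz : IsOrbitVersion Ω Φ η z) {t : ℝ} (ht : 0 ≤ t) :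
    ∀ᵐ x ∂(volume.restrict Ω), y t x = - ∫ s in Ioi t, z s x := by
  have := hstd.isFiniteMeasure
  have hw := hstd.weight_measurable
  have hpos := hstd.weight_pos
  obtain ⟨K, hK0, hK⟩ := hy.exists_bound hstd hS hst
  obtain ⟨K', hK0', hK'⟩ := hz.exists_bound hstd hS hst
  set ρ : ℝ → ℝ := (Ioi t).indicator 1 with hρ
  have hρm : Measurable ρ := measurable_one.indicator measurableSet_Ioi
  have he : Integrable (fun t => Real.exp (ω₀ * t)) halfLine := by
    have : IntegrableOn (fun t => Real.exp (-(-ω₀) * t)) (Ioi 0) :=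
      exp_neg_integrableOn_Ioi 0 (neg_pos.2 hst.1)
    simp only [neg_neg] at this
    exact this
  have hρi : Integrable (fun s => ρ s * Real.exp (ω₀ * s)) halfLine := by
    refine he.mono (by fun_prop) (Eventually.of_forall fun s => ?_)
    rw [norm_mul]
    refine mul_le_of_le_one_left (norm_nonneg _) ?_
    by_cases hs : s ∈ Ioi t
    · rw [hρ, indicator_of_mem hs]; simp
    · rw [hρ, indicator_of_notMem hs]; simp
  have hρint : ∀ g : ℝ → ℝ, ∫ s, ρ s * g s ∂halfLine = ∫ s in Ioi t, g s := fun g => by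
    have h1 : (fun s => ρ s * g s) = (Ioi t).indicator g := by
      ext s
      by_cases hs : s ∈ Ioi t
      · rw [hρ, indicator_of_mem hs, indicator_of_mem hs, Pi.one_apply, one_mul]
      · rw [hρ, indicator_of_notMem hs, indicator_of_notMem hs, zero_mul]
    rw [h1, integral_indicator measurableSet_Ioi, Measure.restrict_restrict measurableSet_Ioi,
      inter_eq_left.2 (Ioi_subset_Ioi ht)]
  -- θ is the defect of the identity; it pairs to zero with all of X, so the duality bound with K =
  -- 0 makes it vanish a.e.
  set θ : E d → ℝ := fun x => y t x + ∫ s, ρ s * z s x ∂halfLine with hθ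
  have hθm : Measurable θ := by
    refine (hy.measurable_apply t).add ?_
    refine (StronglyMeasurable.integral_prod_right (f := fun x s => ρ s * z s x)
      (Measurable.stronglyMeasurable ?_)).measurable
    have h2 : Measurable fun p : E d × ℝ => z p.2 p.1 := hz.meas.comp measurable_swap
    exact (hρm.comp measurable_snd).mul h2
  have hpair : ∀ φ : X Ω w, pairing φ θ = 0 := fun φ => by
    obtain ⟨h1, h2⟩ := hz.pairing_integral hstd hK' hρm hρi φ
    have h3 := integrable_pairing hw hpos φ (hy.measurable_apply t).aemeasurable (hK t ht)
    have h4 : pairing φ θ = pairing φ (y t) + pairing φ (fun x => ∫ s, ρ s * z s x ∂halfLine) := by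
      rw [pairing, pairing, pairing, ← integral_add h3 h1]
      refine integral_congr_ae (Eventually.of_forall fun x => ?_)
      simp only [hθ]
      ring
    rw [h4, h2, hρint, hy.pairing_eq hS ht, h.pairing_eq_integral hstd hS hst φ ht]
    rw [neg_add_eq_zero]
    refine setIntegral_congr_fun measurableSet_Ioi fun s hs => ?_
    exact (hz.pairing_eq hS (ht.trans (le_of_lt hs)) φ).symm
  have h0 := ae_le_of_pairing_le hw hpos hθm.aemeasurable le_rfl fun φ => by
    rw [hpair φ, zero_mul]
  filter_upwards [h0, hpos] with x hx hx0
  have h1 : |θ x| = 0 := le_antisymm (by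
    by_contra hlt
    have := mul_pos (not_le.1 hlt) hx0
    linarith) (abs_nonneg _)
  have h2 : θ x = 0 := abs_eq_zero.1 h1
  rw [← hρint]
  exact eq_neg_of_add_eq_zero_left h2

/-! ### Expansion of the value form for one observable -/

theorem hNorm_sq_eq (hw : Measurable w) (hpos : ∀ᵐ x ∂(volume.restrict Ω), 0 < w x)
    {p : E d → ℝ} (hp : Measurable p) :
    hNorm Ω w p ^ 2 = ∫ x in Ω, (p x * w x) ^ 2 := by
  have h1 : hNorm Ω w p ^ 2 = ∫ x, p x ^ 2 ∂(weightedMeasure Ω fun x => w x ^ 2) := by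
    rw [integral_eq_lintegral_of_nonneg_ae (Eventually.of_forall fun x => sq_nonneg (p x))
      (hp.pow_const 2).aestronglyMeasurable, hNorm, ← ENNReal.toReal_pow]
    congr 1
    have := eLpNorm_nnreal_pow_eq_lintegral (f := p) (p := 2) (by norm_num)
      (μ := weightedMeasure Ω fun x => w x ^ 2)
    simp only [NNReal.coe_ofNat, ENNReal.coe_ofNat, ENNReal.rpow_ofNat] at this
    rw [this]
    refine lintegral_congr fun x => ?_
    rw [Real.enorm_eq_ofReal_abs, ← ENNReal.ofReal_pow (abs_nonneg _), sq_abs]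
  rw [h1, integral_weightedMeasure (hw.pow_const 2) (hpos.mono fun x hx => pow_pos hx 2)]
  simp only [mul_pow]

theorem exists_generator_chain {m : ℕ} {ψ : XDual Ω w} (h : ψ ∈ domGeneratorPow Φ m) :
    ∃ η : ℕ → XDual Ω w, η 0 = ψ ∧ ∀ j < m, IsGeneratorValue Φ (η j) (η (j + 1)) := by
  induction m generalizing ψ with
  | zero => exact ⟨fun _ => ψ, rfl, fun j hj => absurd hj (Nat.not_lt_zero j)⟩
  | succ m ih =>
    obtain ⟨η₁, h1, h2⟩ := h
    obtain ⟨η, h0, hη⟩ := ih h2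
    refine ⟨fun j => Nat.casesOn j ψ η, rfl, fun j hj => ?_⟩
    cases j with
    | zero => rw [← h0] at h1; exact h1
    | succ j => exact hη j (by omega)

/-- Almost every orbit of a chain of generator values is a decaying chain in time. -/
theorem ae_isDecayingChain (hstd : StandingAssumptions Ω f w Φ)
    (hS : IsPreadjoint Φ S) {ω₀ : ℝ} (hst : ExponentiallyStable S ω₀) {k : ℕ}
    {η : ℕ → XDual Ω w} (hη : ∀ j < k, IsGeneratorValue Φ (η j) (η (j + 1)))
    {y : ℕ → ℝ → E d → ℝ} (hy : ∀ j, IsOrbitVersion Ω Φ (η j) (y j)) :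
    ∃ M : ℝ, 0 ≤ M ∧ ∀ᵐ x ∂(volume.restrict Ω),
      IsDecayingChain (-ω₀) M k fun j s => y j s x * w x := by
  have := hstd.isFiniteMeasure
  have hw := hstd.weight_measurable
  choose K hK0 hK using fun j => (hy j).exists_bound hstd hS hst
  have hswap : ∀ j, Measurable fun p : E d × ℝ => y j p.2 p.1 :=
    fun j => (hy j).meas.comp measurable_swap
  -- Statements known for each t at a.e. x become statements at a.e. x for a.e. t, by Fubini. This
  -- is where joint measurability of the orbit versions is needed, here and in the next step.
  have hb : ∀ j, ∀ᵐ x ∂(volume.restrict Ω), ∀ᵐ t ∂halfLine,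
      |y j t x| * w x ≤ K j * Real.exp (ω₀ * t) := fun j => by
    have hset : MeasurableSet {p : E d × ℝ | |y j p.2 p.1| * w p.1 ≤ K j * Real.exp (ω₀ * p.2)} :=
      measurableSet_le ((hswap j).abs.mul (hw.comp measurable_fst)) (by fun_prop)
    rw [Measure.ae_ae_comm hset]
    filter_upwards [ae_restrict_mem measurableSet_Ioi] with t ht using hK j t (le_of_lt ht)
  have hr : ∀ j < k, ∀ᵐ x ∂(volume.restrict Ω), ∀ᵐ t ∂halfLine,
      y j t x = - ∫ s in Ioi t, y (j + 1) s x := fun j hj => by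
    have hm : Measurable fun p : E d × ℝ => ∫ s in Ioi p.2, y (j + 1) s p.1 := by
      have he : (fun p : E d × ℝ => ∫ s in Ioi p.2, y (j + 1) s p.1) = fun p : E d × ℝ =>
          ∫ s, {q : (E d × ℝ) × ℝ | q.1.2 < q.2}.indicator (fun q => y (j + 1) q.2 q.1.1) (p, s) := by
        ext p
        rw [← integral_indicator measurableSet_Ioi]
        rfl
      rw [he]
      refine (StronglyMeasurable.integral_prod_right (f := fun (p : E d × ℝ) (s : ℝ) =>
        {q : (E d × ℝ) × ℝ | q.1.2 < q.2}.indicator (fun q => y (j + 1) q.2 q.1.1) (p, s))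
        (Measurable.stronglyMeasurable ?_)).measurable
      refine Measurable.indicator ?_ ?_
      · exact (hy (j + 1)).meas.comp (measurable_snd.prodMk (measurable_fst.comp measurable_fst))
      · exact measurableSet_lt (measurable_snd.comp measurable_fst) measurable_snd
    have hset : MeasurableSet {p : E d × ℝ | y j p.2 p.1 = - ∫ s in Ioi p.2, y (j + 1) s p.1} :=
      measurableSet_eq_fun (hswap j) hm.neg
    rw [Measure.ae_ae_comm hset]
    filter_upwards [ae_restrict_mem measurableSet_Ioi] with t ht using
      (hη j hj).orbit_eq_integral hstd hS hst (hy j) (hy (j + 1)) (le_of_lt ht)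
  have hKle : ∀ j ≤ k, K j ≤ ∑ i ∈ Finset.range (k + 1), K i := fun j hj =>
    Finset.single_le_sum (fun i _ => hK0 i) (Finset.mem_range.2 (by omega))
  refine ⟨∑ j ∈ Finset.range (k + 1), K j, Finset.sum_nonneg fun j _ => hK0 j, ?_⟩
  have hr' : ∀ᵐ x ∂(volume.restrict Ω), ∀ j, j < k → ∀ᵐ t ∂halfLine,
      y j t x = - ∫ s in Ioi t, y (j + 1) s x := by
    rw [ae_all_iff]
    intro j
    by_cases hj : j < k
    · filter_upwards [hr j hj] with x hx _ using hx
    · exact Eventually.of_forall fun x h => absurd h hj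
  filter_upwards [ae_all_iff.2 hb, hr', hstd.weight_pos] with x h1 h2 hx0
  refine ⟨fun j _ => (((hy j).measurable_orbit x).mul_const _).aestronglyMeasurable,
    fun j hj => ?_, fun j hj => ?_⟩
  · filter_upwards [(ae_restrict_iff' measurableSet_Ioi).1 (h1 j)] with t ht h0
    rw [abs_mul, abs_of_pos hx0, neg_neg]
    exact (ht h0).trans (mul_le_mul_of_nonneg_right (hKle j hj) (Real.exp_pos _).le)
  · filter_upwards [(ae_restrict_iff' measurableSet_Ioi).1 (h2 j hj)] with t ht h0
    rw [ht h0, integral_mul_const, neg_mul]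

theorem inner_toLp_halfLine {g : ℝ → ℝ} (hg : MemLp g 2 halfLine) (e : Lp ℝ 2 halfLine) :
    inner ℝ (hg.toLp g) e = ∫ s, e s * g s ∂halfLine := by
  rw [L2.inner_def]
  refine integral_congr_ae ?_
  filter_upwards [hg.coeFn_toLp] with s hs
  rw [hs]
  simp

/-- The expansion of the value form of a single observable. -/
theorem exists_expansion (hstd : StandingAssumptions Ω f w Φ)
    (hS : IsPreadjoint Φ S) {ω₀ : ℝ} (hst : ExponentiallyStable S ω₀) (k : ℕ)
    {η : ℕ → XDual Ω w} (hη : ∀ j < k, IsGeneratorValue Φ (η j) (η (j + 1))) :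
    ∃ p : ℕ → XDual Ω w,
      (∀ φ φ' : X Ω w,
        IntegrableOn (fun t => pairing (S t φ) (η 0) * pairing (S t φ') (η 0)) (Ioi (0 : ℝ)) ∧
        HasSum (fun n => pairing φ (p n) * pairing φ' (p n))
          (∫ t in Ioi (0 : ℝ), pairing (S t φ) (η 0) * pairing (S t φ') (η 0))) ∧
      ∃ C : ℝ, 0 ≤ C ∧ ∀ (N : ℕ) (s : Finset ℕ), (∀ n ∈ s, N ≤ n) →
        ∑ n ∈ s, hNorm Ω w (p n) ^ 2 ≤ C / ((N : ℝ) + 1) ^ (2 * k) := by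
  have := hstd.isFiniteMeasure
  have hw := hstd.weight_measurable
  have hpos := hstd.weight_pos
  choose y hy using fun j => hstd.exists_isOrbitVersion hS (η j)
  obtain ⟨M, hM0, hchain⟩ := ae_isDecayingChain hstd hS hst hη hy
  obtain ⟨K, hK0, hK⟩ := (hy 0).exists_bound hstd hS hst
  have hω := hst.1
  -- The mesh parameter is chosen so that α * (k + 1) is exactly the available decay rate.
  have hα : 0 < -ω₀ / (k + 1) := div_pos (neg_pos.2 hω) (by positivity)
  have hαk : -ω₀ / (k + 1) * (k + 1) = -ω₀ := div_mul_cancel₀ _ (by positivity)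
  obtain ⟨e, he, D, hD0, hD⟩ := exists_parseval_tail_bound k hα
  rw [hαk] at hD
  have hexp : MemLp (fun t => Real.exp (ω₀ * t)) 2 halfLine := by
    have := memLp_exp_neg (neg_pos.2 hω)
    simp only [neg_neg] at this
    exact this
  have hem : ∀ n, Measurable (e n) := fun n => (Lp.stronglyMeasurable (e n)).measurable
  have hei : ∀ n, Integrable (fun s => e n s * Real.exp (ω₀ * s)) halfLine :=
    fun n => (Lp.memLp (e n)).integrable_mul hexp
  -- The functions p_n: weak-* integrals of the orbit of the observable against the frame vectors.
  let q : ℕ → E d → ℝ := fun n x => ∫ s, e n s * y 0 s x ∂halfLine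
  have hqm : ∀ n, Measurable (q n) := fun n => by
    refine (StronglyMeasurable.integral_prod_right (f := fun x s => e n s * y 0 s x)
      (Measurable.stronglyMeasurable ?_)).measurable
    exact ((hem n).comp measurable_snd).mul ((hy 0).meas.comp measurable_swap)
  -- For fixed x, q n x * w x is the n-th frame coefficient of the weighted orbit through x; the
  -- bound is uniform in x because the frame and the constants are.
  have htail : ∀ᵐ x ∂(volume.restrict Ω), ∀ (N : ℕ) (s : Finset ℕ), (∀ n ∈ s, N ≤ n) →
      ∑ n ∈ s, (q n x * w x) ^ 2 ≤ (D * M / (N + 1) ^ k) ^ 2 := by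
    filter_upwards [hchain] with x hx N s hs
    have hL2 : MemLp (fun s => y 0 s x * w x) 2 halfLine :=
      memLp_of_exp_bound (neg_pos.2 hω) (hx.meas 0 (Nat.zero_le _)) (hx.bound 0 (Nat.zero_le _))
    refine le_trans (le_of_eq ?_) (hD M _ hM0 hx hL2 N s hs)
    refine Finset.sum_congr rfl fun n _ => ?_
    rw [inner_toLp_halfLine, ← integral_mul_const]
    congr 2
    ext s
    ring
  have hqb : ∀ n, ∀ᵐ x ∂(volume.restrict Ω), |q n x| * w x ≤ D * M := fun n => by
    filter_upwards [htail, hpos] with x hx hx0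
    have h1 := hx 0 {n} fun _ _ => Nat.zero_le _
    simp only [Finset.sum_singleton, Nat.cast_zero, zero_add, one_pow, div_one] at h1
    have h2 := abs_le_of_sq_le_sq h1 (by positivity)
    rwa [abs_mul, abs_of_pos hx0] at h2
  refine ⟨fun n => ⟨q n, mem_XDual_of_bound hw hpos (hqm n).aemeasurable (hqb n)⟩,
    fun φ φ' => ?_, (D * M) ^ 2 * (volume.restrict Ω).real univ, by positivity, fun N s hs => ?_⟩
  · have hF : ∀ φ : X Ω w, MemLp (fun t => pairing φ (y 0 t)) 2 halfLine := fun φ => by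
      refine memLp_of_exp_bound (M := K * ‖φ‖) (neg_pos.2 hω)
        ((hy 0).measurable_pairing hw φ).aestronglyMeasurable (Eventually.of_forall fun t ht => ?_)
      rw [(hy 0).pairing_eq hS ht.le, neg_neg]
      exact (hy 0).abs_pairing_le hstd hS hK φ ht.le
    -- Fubini: integrating first in x identifies the pairing with q n as a coefficient of the curve
    -- of φ in the same frame.
    have hinner : ∀ (φ : X Ω w) n, inner ℝ ((hF φ).toLp _) (e n) = pairing φ (q n) :=
      fun φ n => by
        rw [inner_toLp_halfLine, ((hy 0).pairing_integral hstd hK (hem n) (hei n) φ).2]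
    have hcongr : (fun t => pairing φ (y 0 t) * pairing φ' (y 0 t)) =ᵐ[halfLine]
        fun t => pairing (S t φ) (η 0) * pairing (S t φ') (η 0) := by
      filter_upwards [ae_restrict_mem measurableSet_Ioi] with t ht
      rw [(hy 0).pairing_eq hS (le_of_lt ht), (hy 0).pairing_eq hS (le_of_lt ht)]
    refine ⟨((hF φ).integrable_mul (hF φ')).congr hcongr, ?_⟩
    have h1 := he ((hF φ).toLp _) ((hF φ').toLp _)
    simp only [hinner] at h1
    rw [inner_toLp_halfLine] at h1
    convert h1 using 1
    refine integral_congr_ae ?_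
    filter_upwards [hcongr, (hF φ').coeFn_toLp] with t h2 h3
    rw [← h2, h3, mul_comm]
  · have hint : ∀ n, Integrable (fun x => (q n x * w x) ^ 2) (volume.restrict Ω) := fun n => by
      refine Integrable.of_bound (((hqm n).mul hw).pow_const 2).aestronglyMeasurable
        ((D * M) ^ 2) ?_
      filter_upwards [hqb n, hpos] with x hx hx0
      rw [norm_pow, norm_mul, Real.norm_of_nonneg hx0.le]
      exact pow_le_pow_left₀ (by positivity) hx 2
    calc ∑ n ∈ s, hNorm Ω w (q n) ^ 2 = ∑ n ∈ s, ∫ x in Ω, (q n x * w x) ^ 2 :=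
          Finset.sum_congr rfl fun n _ => hNorm_sq_eq hw hpos (hqm n)
      _ = ∫ x in Ω, ∑ n ∈ s, (q n x * w x) ^ 2 := (integral_finsetSum s fun n _ => hint n).symm
      _ ≤ ∫ x in Ω, (D * M / (N + 1) ^ k) ^ 2 := by
          refine integral_mono_ae (integrable_finsetSum s fun n _ => hint n)
            (integrable_const _) ?_
          filter_upwards [htail] with x hx using hx N s hs
      _ = _ := by
          rw [integral_const, smul_eq_mul, div_pow, ← pow_mul, mul_comm k 2]
          ring

/-! ### Several observables -/

theorem observationAdjoint_single {r : ℕ} (c : Fin r → XDual Ω w) (i : Fin r) :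
    observationAdjoint c (EuclideanSpace.single i 1) = c i := by
  rw [observationAdjoint, Finset.sum_eq_single i]
  · simp
  · intro j _ hj
    simp [hj]
  · simp

/-- Families of nonnegative sequences interleaved along `n = q * r + i`. -/
theorem sum_interleave_le {r : ℕ} [NeZero r] {h : Fin r → ℕ → ℝ} (h0 : ∀ i q, 0 ≤ h i q)
    {B : Fin r → ℕ → ℝ} (hB : ∀ i Q (s : Finset ℕ), (∀ q ∈ s, Q ≤ q) → ∑ q ∈ s, h i q ≤ B i Q)
    (N : ℕ) (s : Finset ℕ) (hs : ∀ n ∈ s, N ≤ n) :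
    ∑ n ∈ s, h (Nat.divModEquiv r n).2 (Nat.divModEquiv r n).1 ≤ ∑ i, B i (N / r) := by
  classical
  set T : Finset ℕ := s.image (· / r)
  calc ∑ n ∈ s, h (Nat.divModEquiv r n).2 (Nat.divModEquiv r n).1
      = ∑ z ∈ s.map (Nat.divModEquiv r).toEmbedding, h z.2 z.1 := by simp
    _ ≤ ∑ z ∈ T ×ˢ Finset.univ, h z.2 z.1 := by
        refine Finset.sum_le_sum_of_subset_of_nonneg ?_ fun z _ _ => h0 _ _
        intro z hz
        obtain ⟨n, hn, rfl⟩ := Finset.mem_map.1 hz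
        exact Finset.mem_product.2 ⟨Finset.mem_image_of_mem _ hn, Finset.mem_univ _⟩
    _ = ∑ i, ∑ q ∈ T, h i q := Finset.sum_product_right _ _ _
    _ ≤ ∑ i, B i (N / r) := by
        refine Finset.sum_le_sum fun i _ => hB i _ T fun q hq => ?_
        obtain ⟨n, hn, rfl⟩ := Finset.mem_image.1 hq
        exact Nat.div_le_div_right (hs n hn)

theorem hasSum_interleave {r : ℕ} [NeZero r] {g : Fin r → ℕ → ℝ} {a : Fin r → ℝ}
    (hg : ∀ i, HasSum (g i) (a i)) :
    HasSum (fun n => g (Nat.divModEquiv r n).2 (Nat.divModEquiv r n).1) (∑ i, a i) := by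
  classical
  have h1 : ∀ i, HasSum (fun z : ℕ × Fin r => if z.2 = i then g i z.1 else 0) (a i) := fun i => by
    have hinj : Function.Injective fun q : ℕ => (q, i) := fun q q' h => (Prod.mk.inj h).1
    refine (hinj.hasSum_iff fun z hz => ?_).1 (by simpa [Function.comp_def] using hg i)
    rw [if_neg]
    rintro rfl
    exact hz ⟨z.1, rfl⟩
  have h2 := hasSum_sum fun i (_ : i ∈ Finset.univ) => h1 i
  simp only [Finset.sum_ite_eq, Finset.mem_univ, if_true] at h2
  exact (Equiv.hasSum_iff (Nat.divModEquiv r)).2 h2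

theorem inner_observation {r : ℕ} (c : Fin r → XDual Ω w) (φ ψ : X Ω w) :
    inner ℝ (observation c φ) (observation c ψ) = ∑ i, pairing φ (c i) * pairing ψ (c i) := by
  simp only [observation, PiLp.inner_apply]
  refine Finset.sum_congr rfl fun i _ => ?_
  simp [mul_comm]

end KoopmanLyapunov

end

theorem mainTheorem3 {d : ℕ} (Ω : Set (KoopmanLyapunov.E d))
    (f : KoopmanLyapunov.E d → KoopmanLyapunov.E d) (w : KoopmanLyapunov.E d → ℝ)
    (Φ : ℝ → KoopmanLyapunov.E d → KoopmanLyapunov.E d)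
    (hstd : KoopmanLyapunov.StandingAssumptions Ω f w Φ)
    (S : ℝ → KoopmanLyapunov.X Ω w →L[ℝ] KoopmanLyapunov.X Ω w)
    (hS : KoopmanLyapunov.IsPreadjoint Φ S)
    (ω₀ : ℝ) (hstable : KoopmanLyapunov.ExponentiallyStable S ω₀)
    (r : ℕ) (c : Fin r → KoopmanLyapunov.XDual Ω w)
    (m : ℕ) (hm : Even m)
    (hrange : Set.range (KoopmanLyapunov.observationAdjoint c) ⊆
      KoopmanLyapunov.domGeneratorPow Φ m) :
    ∃ p : ℕ → KoopmanLyapunov.XDual Ω w,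
      (∀ φ ψ : KoopmanLyapunov.X Ω w,
        IntegrableOn (fun t => inner ℝ (KoopmanLyapunov.observation c (S t φ))
          (KoopmanLyapunov.observation c (S t ψ))) (Ioi (0 : ℝ)) ∧
        HasSum (fun n => KoopmanLyapunov.pairing φ (p n) * KoopmanLyapunov.pairing ψ (p n))
          (KoopmanLyapunov.valueForm c S φ ψ)) ∧
      Summable (fun n => KoopmanLyapunov.hNorm Ω w (p n) ^ 2) ∧
      (fun N : ℕ => ∑' n, KoopmanLyapunov.hNorm Ω w (p (N + n)) ^ 2)
        =O[atTop] (fun N : ℕ => ((N : ℝ) ^ m)⁻¹) := by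
  open KoopmanLyapunov in
  -- Interleaving by quotient and remainder modulo r requires r ≠ 0; for r = 0 the form is zero.
  rcases Nat.eq_zero_or_pos r with rfl | hr
  · have hN : hNorm Ω w 0 = 0 := by simp [hNorm]
    refine ⟨0, fun φ ψ => ⟨?_, ?_⟩, ?_, ?_⟩
    · simp [inner_observation]
    · simp [valueForm, inner_observation, pairing]
    · simp [hN]
    · simpa [hN] using Asymptotics.isBigO_zero (E' := ℝ) (fun N : ℕ => ((N : ℝ) ^ m)⁻¹) atTop
  have : NeZero r := ⟨hr.ne'⟩
  -- With m = k + k, the first k steps of each generator chain suffice: squared tails have exponent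
  -- 2k = m.
  obtain ⟨k, hk⟩ := hm
  choose η hη0 hη using fun i => exists_generator_chain
    (hrange ⟨EuclideanSpace.single i 1, observationAdjoint_single c i⟩)
  choose P hP C hC0 hC using fun i => exists_expansion hstd hS hstable k
    (fun j hj => hη i j (by omega))
  simp only [hη0] at hP
  have h2k : 2 * k = m := by omega
  rw [h2k] at hC
  have hsum := sum_interleave_le (r := r) (h := fun i q => hNorm Ω w (P i q) ^ 2)
    (fun _ _ => sq_nonneg _) hC
  -- Indices n ≥ N have quotient at least N / r, and N ≤ r * (N / r + 1) converts the rate at the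
  -- cost of r ^ m. The case N = 0 is set apart because the right side is then 0 when m > 0, as `0⁻¹
  -- = 0`.
  have hbound : ∀ N : ℕ, ∑ i, C i / (((N / r : ℕ) : ℝ) + 1) ^ m ≤
      (∑ i, C i) * r ^ m * ((N : ℝ) ^ m)⁻¹ ∨ N = 0 := by
    intro N
    rcases Nat.eq_zero_or_pos N with hN | hN
    · exact Or.inr hN
    left
    rw [← Finset.sum_div, mul_assoc, div_eq_mul_inv]
    refine mul_le_mul_of_nonneg_left ?_ (Finset.sum_nonneg fun i _ => hC0 i)
    have hN' : (0 : ℝ) < N := by exact_mod_cast hN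
    have h1 : (N : ℝ) ≤ r * (((N / r : ℕ) : ℝ) + 1) := by
      exact_mod_cast (Nat.lt_mul_div_succ N hr).le
    rw [← div_eq_mul_inv, ← div_pow, ← inv_pow]
    refine pow_le_pow_left₀ (by positivity) ?_ m
    rw [inv_le_iff_one_le_mul₀ (by positivity), div_mul_eq_mul_div, le_div_iff₀ hN', one_mul]
    exact h1
  refine ⟨fun n => P (Nat.divModEquiv r n).2 (Nat.divModEquiv r n).1, fun φ ψ => ⟨?_, ?_⟩, ?_, ?_⟩
  · simp only [inner_observation]
    exact integrable_finsetSum _ fun i _ => (hP i φ ψ).1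
  · have hv : valueForm c S φ ψ =
        ∑ i, ∫ t in Ioi (0 : ℝ), pairing (S t φ) (c i) * pairing (S t ψ) (c i) := by
      simp only [valueForm, inner_observation]
      exact integral_finsetSum _ fun i _ => (hP i φ ψ).1
    rw [hv]
    exact hasSum_interleave fun i => (hP i φ ψ).2
  · exact summable_of_sum_le (fun _ => sq_nonneg _) fun s => hsum 0 s fun _ _ => Nat.zero_le _
  · refine Asymptotics.IsBigO.of_bound ((∑ i, C i) * r ^ m) ?_
    filter_upwards [eventually_gt_atTop 0] with N hN
    rw [Real.norm_of_nonneg (tsum_nonneg fun _ => sq_nonneg _), Real.norm_of_nonneg (by positivity)]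
    refine le_trans ?_ ((hbound N).resolve_right hN.ne')
    refine Real.tsum_le_of_sum_le (fun _ => sq_nonneg _) fun s => ?_
    have := hsum N (s.map (addLeftEmbedding N)) (by simp)
    simpa using this
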